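/- Let $n>1$ be an integer, let $B=\{z\in\mathbb C^n:|z|<1\}$ and $S=\{z\in\mathbb C^n:|z|=1\}$, let $\langle z,w\rangle=\sum_{j=1}^n z_j\overline{w_j}$, and let $\sigma$ be the Lebesgue (surface) measure on $S$ normalized by $\sigma(S)=1$. For $w\in B$ and $z\in B$ put $$\varphi_w(z)=\frac{w-P_wz-(1-|w|^2)^{1/2}(z-P_wz)}{1-\langle z,w\rangle},\qquad P_wz=\frac{\langle z,w\rangle}{|w|^2}\,w\ (w\ne0),\quad P_0z=0,$$ $$g(z)=\frac{n+1}{2n}\int_{|z|}^1(1-t^2)^{n-1}t^{-2n+1}\,dt\in[0,\infty],\qquad G(z,w)=g(\varphi_w(z)).$$ For a nonnegative Borel measure $\mu$ on $B$ let $G_\mu(z)=\int_B G(z,w)\,d\mu(w)$ be its invariant Green potential, let $$m_p(r,G_\mu)=\Bigl(\int_S G_\mu(r\xi)^p\,d\sigma(\xi)\Bigr)^{1/p},$$ let $d\lambda(z)=(1-|z|)^n\,d\mu(z)$, and for $\xi\in S$, $\delta>0$ let $C(\xi,\delta)=\{z\in B:|1-\langle z,\xi\rangle|^{1/2}<\delta^{1/2}\}$.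 Let $1<p<\frac{2n-1}{2(n-1)}$, let $\mu$ be a nonnegative Borel measure on $B$ with $\int_B(1-|w|^2)^n\,d\mu(w)<\infty$, and let $0<r_0<1$. Then $m_p(r,G_\mu)$ is bounded on $r_0\le r<1$ if and only if $$\Bigl(\int_S\lambda^p\bigl(C(\xi,\delta)\bigr)\,d\sigma(\xi)\Bigr)^{1/p}=O(\delta^n),\qquad 0<\delta<1,$$ that is, there is a constant $K<\infty$ (which may depend on $n$, $p$, $\mu$) such that the left-hand side is at most $K\delta^n$ for every $\delta\in(0,1)$. (In particular, this condition is equivalent to $m_p(r,G_\mu)=O(1)$ as $r\uparrow1$.) -/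

import Mathlib

open MeasureTheory
open scoped ENNReal NNReal

noncomputable section

namespace InvariantGreen

/-- The space `ℂⁿ` with its Hermitian inner product. Mathlib's `inner ℂ w z` is conjugate linear
in the first argument, so the product `⟨z, w⟩ = ∑ⱼ zⱼ * conj wⱼ` is `inner ℂ w z`. -/
abbrev Cn (n : ℕ) : Type := EuclideanSpace ℂ (Fin n)

/-- The open unit ball `B` of `ℂⁿ`. -/
abbrev B (n : ℕ) : Type := Metric.ball (0 : Cn n) 1

/-- The unit sphere `S` of `ℂⁿ`. -/
abbrev S (n : ℕ) : Type := Metric.sphere (0 : Cn n) 1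

/-- The surface (Lebesgue) measure on `S`, normalized to total mass one. -/
def sigma (n : ℕ) : Measure (S n) :=
  ((volume : Measure (Cn n)).toSphere Set.univ)⁻¹ • (volume : Measure (Cn n)).toSphere

/-- The orthogonal projection `P_w z = (⟨z, w⟩ / |w|²) w` of `ℂⁿ` onto the span of `w`, with
`P_0 z = 0`. -/
def proj {n : ℕ} (w z : Cn n) : Cn n :=
  (inner ℂ w z / (‖w‖ : ℂ) ^ 2) • w

/-- The involutive automorphism
`φ_w(z) = (w - P_w z - (1 - |w|²)^{1/2} Q_w z) / (1 - ⟨z, w⟩)`, where `Q_w = I - P_w`. -/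
def phi {n : ℕ} (w z : Cn n) : Cn n :=
  (1 - inner ℂ w z)⁻¹ • (w - proj w z - Real.sqrt (1 - ‖w‖ ^ 2) • (z - proj w z))

/-- `g(z) = (n + 1) / (2 n) ∫_{|z|}^1 (1 - t²)^{n-1} t^{-2n+1} dt`, with values in `[0, ∞]`. -/
def g {n : ℕ} (z : Cn n) : ℝ≥0∞ :=
  ENNReal.ofReal (((n : ℝ) + 1) / (2 * n)) *
    ∫⁻ t in Set.Ioo ‖z‖ 1,
      ENNReal.ofReal ((1 - t ^ 2) ^ ((n : ℤ) - 1) * t ^ (-2 * (n : ℤ) + 1))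

/-- The Green function `G(z, w) = g(φ_w(z))` of the invariant Laplacian. -/
def green {n : ℕ} (z w : Cn n) : ℝ≥0∞ := g (phi w z)

/-- The invariant Green potential `G_μ(z) = ∫_B G(z, w) dμ(w)` (for `z` in the ball). -/
def greenPotential {n : ℕ} (μ : Measure (B n)) (z : Cn n) : ℝ≥0∞ :=
  ∫⁻ w : B n, green z (w : Cn n) ∂μ

/-- The mean `m_p(r, u) = (∫_S |u(r ξ)|^p dσ(ξ))^{1/p}` of a function with values in `[0, ∞]`. -/
def pMean {n : ℕ} (p r : ℝ) (u : Cn n → ℝ≥0∞) : ℝ≥0∞ :=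
  (∫⁻ ξ : S n, u (r • (ξ : Cn n)) ^ p ∂(sigma n)) ^ (1 / p)

/-- The anisotropic metric `d(a, b) = |1 - ⟨a, b⟩|^{1/2}`. -/
def anisoDist {n : ℕ} (a b : Cn n) : ℝ := Real.sqrt ‖1 - inner ℂ b a‖

/-- `C(ξ, δ) = {z ∈ B : d(z, ξ) < δ^{1/2}}`. -/
def carleson {n : ℕ} (ξ : S n) (δ : ℝ) : Set (B n) :=
  {z | anisoDist (z : Cn n) (ξ : Cn n) < Real.sqrt δ}

/-- The weighted measure `dλ(z) = (1 - |z|)ⁿ dμ(z)`. -/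
def lam {n : ℕ} (μ : Measure (B n)) : Measure (B n) :=
  μ.withDensity fun z => ENNReal.ofReal ((1 - ‖(z : Cn n)‖) ^ n)

end InvariantGreen

end

/-!
Write `D(z, w) = |1 - ⟨z, w⟩|` and `h = 1 - r`. The identity
`1 - |φ_w(z)|² = (1 - |w|²)(1 - |z|²) / D(z, w)²` and the size of `g` reduce everything to `D`,
which is a quasi-metric on the closed ball (`norm_one_sub_inner_le`).

From the means to the averaged Carleson condition: `g(z) ≥ c (1 - |z|²)ⁿ`, and for
`w ∈ C(ξ, δ)` and `1 - r` comparable to `δ` this gives `G(rξ, w) ≥ c ((1 - |w|) / δ)ⁿ`, hence the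
pointwise bound `λ(C(ξ, δ)) ≤ C δⁿ G_μ(rξ)` (`exists_lam_carleson_le`).

From the condition to the means: the Green function is cut dyadically (`exists_green_le`). Away from
the pole, `g(z) ≤ C (1 - |z|²)ⁿ` bounds the potential by
`∑ₖ h⁻ⁿ 4⁻ⁿᵏ λ(C(ξ, 2ᵏ⁺² h))`, whose `L^p` norm is a convergent geometric series. Near the pole,
`g(z) ≤ C |z|^{-(2n-2)}` leads to `∑ₖ 2^{(2n-2)k} μ(E(rξ, ε 2⁻ᵏ))` with pseudo-hyperbolic balls
`E(z, τ) = {w : |φ_w(z)| ≤ τ}`. The main point is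
`‖μ(E(rξ, τ))‖_p ≤ C τ^{(2n-1)/p}` (`exists_lintegral_pseudoBall_le`), which makes the series
converge exactly when `p < (2n-1)/(2n-2)`. It follows from Tonelli's theorem
(`lintegral_measure_slice_rpow_le`) and two estimates of surface measure: the set of `ξ` with
`w ∈ E(rξ, τ)` lies in an anisotropic box of measure at most `C τ^{2n-1} hⁿ`
(`exists_sigma_pseudoBall_le`), while anisotropic balls of radius `h` have measure at least `c hⁿ`
(`exists_le_sigma_ball`). Both come from comparing cones over subsets of the sphere with products of
a rectangle and discs, after a rotation.
-/

namespace InvariantGreen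

/-! ### The triangle inequality in `L^p` for series -/

lemma lintegral_Lp_sum_le {α : Type*} [MeasurableSpace α] {ν : Measure α} {p : ℝ} (hp : 1 ≤ p)
    {f : ℕ → α → ℝ≥0∞} (hf : ∀ k, Measurable (f k)) (N : ℕ) :
    (∫⁻ a, (∑ k ∈ Finset.range N, f k a) ^ p ∂ν) ^ (1 / p) ≤
      ∑ k ∈ Finset.range N, (∫⁻ a, f k a ^ p ∂ν) ^ (1 / p) := by
  have hp0 : 0 < p := by linarith
  induction N with
  | zero => simp [ENNReal.zero_rpow_of_pos hp0, hp0]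
  | succ N ih =>
    simp only [Finset.sum_range_succ]
    refine (ENNReal.lintegral_Lp_add_le (μ := ν)
      (f := fun a => ∑ k ∈ Finset.range N, f k a) (g := f N)
      (Finset.measurable_fun_sum _ fun k _ => hf k).aemeasurable (hf N).aemeasurable hp).trans ?_
    gcongr

lemma lintegral_Lp_tsum_le {α : Type*} [MeasurableSpace α] {ν : Measure α} {p : ℝ} (hp : 1 ≤ p)
    {f : ℕ → α → ℝ≥0∞} (hf : ∀ k, Measurable (f k)) :
    (∫⁻ a, (∑' k, f k a) ^ p ∂ν) ^ (1 / p) ≤ ∑' k, (∫⁻ a, f k a ^ p ∂ν) ^ (1 / p) := by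
  have hp0 : 0 < p := by linarith
  have hsup : ∀ (q : ℝ), 0 < q → ∀ u : ℕ → ℝ≥0∞, (⨆ N, u N) ^ q = ⨆ N, u N ^ q :=
    fun q hq u => (ENNReal.orderIsoRpow q hq).map_iSup u
  have hmono : ∀ a, Monotone fun N => ∑ k ∈ Finset.range N, f k a := fun a =>
    monotone_nat_of_le_succ fun N => by rw [Finset.sum_range_succ]; exact le_self_add
  simp only [ENNReal.tsum_eq_iSup_nat, hsup p hp0]
  rw [lintegral_iSup (fun N => (Finset.measurable_fun_sum _ fun k _ => hf k).pow_const p)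
    (fun i j hij a => ENNReal.rpow_le_rpow (hmono a hij) hp0.le), hsup _ (by positivity)]
  exact iSup_mono fun N => lintegral_Lp_sum_le hp hf N

/-! ### Geometry of the ball -/

lemma norm_inner_le_of_norm_le_one {n : ℕ} {a b : Cn n} (ha : ‖a‖ ≤ 1) :
    ‖inner ℂ b a‖ ≤ ‖b‖ := by
  have := norm_inner_le_norm (𝕜 := ℂ) b a
  nlinarith [norm_nonneg b]

lemma one_sub_norm_le_norm_one_sub_inner {n : ℕ} {a b : Cn n} (ha : ‖a‖ ≤ 1) :
    1 - ‖b‖ ≤ ‖1 - inner ℂ b a‖ := by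
  have h1 := norm_sub_norm_le (1 : ℂ) (inner ℂ b a)
  have h2 := norm_inner_le_of_norm_le_one (b := b) ha
  simp only [norm_one] at h1
  linarith

lemma norm_one_sub_inner_comm {n : ℕ} (a b : Cn n) :
    ‖1 - inner ℂ b a‖ = ‖1 - inner ℂ a b‖ := by
  rw [← RCLike.norm_conj (1 - inner ℂ b a), map_sub, map_one, inner_conj_symm]

lemma norm_sub_sq_le_norm_one_sub_inner {n : ℕ} {a b : Cn n} (ha : ‖a‖ ≤ 1) (hb : ‖b‖ ≤ 1) :
    ‖a - b‖ ^ 2 ≤ 2 * ‖1 - inner ℂ b a‖ := by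
  have h1 := norm_sub_sq (𝕜 := ℂ) b a
  have h2 := Complex.re_le_norm (1 - inner ℂ b a)
  simp only [Complex.sub_re, Complex.one_re, RCLike.re_eq_complex_re] at h1 h2
  rw [norm_sub_rev, h1]
  nlinarith [norm_nonneg a, norm_nonneg b]

/-- The square of the anisotropic distance is a quasi-metric on the closed ball. -/
lemma norm_one_sub_inner_le {n : ℕ} {a b c : Cn n} (ha : ‖a‖ ≤ 1) (hb : ‖b‖ ≤ 1) (hc : ‖c‖ ≤ 1) :
    ‖1 - inner ℂ c a‖ ≤ 4 * (‖1 - inner ℂ b a‖ + ‖1 - inner ℂ c b‖) := by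
  have key : 1 - inner ℂ c a = (1 - inner ℂ b a) + inner ℂ (b - c) (a - b) +
      ((1 - inner ℂ c b) - (1 - inner ℂ b b)) := by
    simp only [inner_sub_left, inner_sub_right]; ring
  have h1 := norm_sub_sq_le_norm_one_sub_inner ha hb
  have h2 := norm_sub_sq_le_norm_one_sub_inner hb hc
  have h3 := norm_inner_le_norm (𝕜 := ℂ) (b - c) (a - b)
  have h4 : ‖(1 : ℂ) - inner ℂ b b‖ ≤ 2 * ‖1 - inner ℂ b a‖ := by
    have h5 := one_sub_norm_le_norm_one_sub_inner (b := b) ha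
    have h6 : (1 : ℂ) - inner ℂ b b = ((1 - ‖b‖ ^ 2 : ℝ) : ℂ) := by
      rw [inner_self_eq_norm_sq_to_K]; push_cast; rfl
    rw [h6, Complex.norm_real, Real.norm_of_nonneg (by nlinarith [norm_nonneg b])]
    nlinarith [norm_nonneg b]
  rw [key]
  have t1 := norm_add_le ((1 - inner ℂ b a) + inner ℂ (b - c) (a - b))
    ((1 - inner ℂ c b) - (1 - inner ℂ b b))
  have t2 := norm_add_le (1 - inner ℂ b a) (inner ℂ (b - c) (a - b))
  have t3 := norm_sub_le (1 - inner ℂ c b) (1 - inner ℂ b b)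
  nlinarith [two_mul_le_add_sq ‖b - c‖ ‖a - b‖, norm_nonneg (1 - inner ℂ c b)]

lemma norm_one_sub_inner_le_add {n : ℕ} {a w : Cn n} {r : ℝ} (ha : ‖a‖ ≤ 1) (hw : ‖w‖ ≤ 1)
    (hr : r ≤ 1) :
    ‖1 - inner ℂ w a‖ ≤ ‖1 - inner ℂ w (r • a)‖ + (1 - r) := by
  have h : 1 - inner ℂ w a = (1 - inner ℂ w (r • a)) - ((1 - r : ℝ) : ℂ) * inner ℂ w a := by
    rw [← Complex.coe_smul, inner_smul_right]; push_cast; ring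
  rw [h]
  refine (norm_sub_le _ _).trans ?_
  rw [norm_mul, Complex.norm_real, Real.norm_of_nonneg (by linarith)]
  nlinarith [norm_inner_le_of_norm_le_one (b := w) ha, norm_nonneg (inner ℂ w a)]

lemma norm_one_sub_inner_smul_le_add {n : ℕ} {a w : Cn n} {r : ℝ} (ha : ‖a‖ ≤ 1) (hw : ‖w‖ ≤ 1)
    (hr : r ≤ 1) :
    ‖1 - inner ℂ w (r • a)‖ ≤ ‖1 - inner ℂ w a‖ + (1 - r) := by
  have h : 1 - inner ℂ w (r • a) = (1 - inner ℂ w a) + ((1 - r : ℝ) : ℂ) * inner ℂ w a := by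
    rw [← Complex.coe_smul, inner_smul_right]; push_cast; ring
  rw [h]
  refine (norm_add_le _ _).trans ?_
  rw [norm_mul, Complex.norm_real, Real.norm_of_nonneg (by linarith)]
  nlinarith [norm_inner_le_of_norm_le_one (b := w) ha, norm_nonneg (inner ℂ w a)]

lemma one_sub_le_norm_one_sub_inner_smul {n : ℕ} {a w : Cn n} {r : ℝ} (ha : ‖a‖ ≤ 1)
    (hw : ‖w‖ ≤ 1) (hr : 0 ≤ r) :
    1 - r ≤ ‖1 - inner ℂ w (r • a)‖ := by
  rw [norm_one_sub_inner_comm]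
  refine le_trans ?_ (one_sub_norm_le_norm_one_sub_inner hw)
  rw [norm_smul, Real.norm_of_nonneg hr]
  nlinarith

/-- The fundamental identity for the automorphisms of the ball, multiplied out. -/
lemma norm_phi_sq_mul {n : ℕ} {w z : Cn n} (hw : ‖w‖ ≤ 1) (h : 1 - inner ℂ w z ≠ 0) :
    ‖phi w z‖ ^ 2 * ‖1 - inner ℂ w z‖ ^ 2 =
      ‖1 - inner ℂ w z‖ ^ 2 - (1 - ‖w‖ ^ 2) * (1 - ‖z‖ ^ 2) := by
  have hD : ‖1 - inner ℂ w z‖ ≠ 0 := norm_ne_zero_iff.mpr h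
  rw [phi, norm_smul, norm_inv, mul_pow, inv_pow, mul_comm, mul_inv_cancel_left₀ (by positivity)]
  have hexp : ‖1 - inner ℂ w z‖ ^ 2 = 1 - 2 * (inner ℂ w z).re + ‖inner ℂ w z‖ ^ 2 := by
    rw [Complex.sq_norm, Complex.sq_norm, Complex.normSq_apply, Complex.normSq_apply]
    simp only [Complex.sub_re, Complex.one_re, Complex.sub_im, Complex.one_im]; ring
  rw [hexp]
  rcases eq_or_ne w 0 with rfl | hw0
  · simp [proj]
  have hwn : ‖w‖ ≠ 0 := norm_ne_zero_iff.mpr hw0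
  have hwc : (‖w‖ : ℂ) ≠ 0 := by exact_mod_cast hwn
  have hww : inner ℂ w w = (‖w‖ : ℂ) ^ 2 := inner_self_eq_norm_sq_to_K w
  have horth : inner ℂ w (z - proj w z) = 0 := by
    rw [proj, inner_sub_right, inner_smul_right, hww]
    field_simp; ring
  have h1 : ‖w - proj w z‖ ^ 2 =
      ‖w‖ ^ 2 - 2 * (inner ℂ w z).re + ‖inner ℂ w z‖ ^ 2 / ‖w‖ ^ 2 := by
    have e1 : w - proj w z = (1 - inner ℂ w z / (‖w‖ : ℂ) ^ 2) • w := by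
      rw [proj, sub_smul, one_smul]
    have e2 : (1 - inner ℂ w z / (‖w‖ : ℂ) ^ 2) =
        ((‖w‖ ^ 2 - (inner ℂ w z) : ℂ)) / (‖w‖ : ℂ) ^ 2 := by field_simp
    have e3 : ‖(‖w‖ ^ 2 - (inner ℂ w z) : ℂ)‖ ^ 2 =
        ‖w‖ ^ 4 - 2 * ‖w‖ ^ 2 * (inner ℂ w z).re + ‖inner ℂ w z‖ ^ 2 := by
      rw [← Complex.ofReal_pow, Complex.sq_norm, Complex.sq_norm, Complex.normSq_apply,
        Complex.normSq_apply]
      simp only [Complex.sub_re, Complex.ofReal_re, Complex.sub_im, Complex.ofReal_im]; ring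
    rw [e1, norm_smul, e2, norm_div, mul_pow, div_pow, e3, norm_pow, Complex.norm_real, norm_norm]
    field_simp
  have h2 : ‖z - proj w z‖ ^ 2 = ‖z‖ ^ 2 - ‖inner ℂ w z‖ ^ 2 / ‖w‖ ^ 2 := by
    have e1 : ‖z‖ ^ 2 = ‖proj w z‖ ^ 2 + ‖z - proj w z‖ ^ 2 := by
      have := norm_add_sq_eq_norm_sq_add_norm_sq_of_inner_eq_zero (𝕜 := ℂ)
        (proj w z) (z - proj w z) (by
          have : proj w z = (inner ℂ w z / (‖w‖ : ℂ) ^ 2) • w := rfl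
          rw [this, inner_smul_left, ← this, horth, mul_zero])
      rw [add_sub_cancel] at this
      nlinarith
    have e2 : ‖proj w z‖ ^ 2 = ‖inner ℂ w z‖ ^ 2 / ‖w‖ ^ 2 := by
      rw [proj, norm_smul, norm_div, norm_pow, Complex.norm_real, norm_norm, mul_pow]
      field_simp
    linarith
  have h3 : ‖w - proj w z - Real.sqrt (1 - ‖w‖ ^ 2) • (z - proj w z)‖ ^ 2 =
      ‖w - proj w z‖ ^ 2 + (1 - ‖w‖ ^ 2) * ‖z - proj w z‖ ^ 2 := by
    have hs : 0 ≤ 1 - ‖w‖ ^ 2 := by nlinarith [norm_nonneg w]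
    have e0 : inner ℂ (w - proj w z) (-(Real.sqrt (1 - ‖w‖ ^ 2) • (z - proj w z))) = 0 := by
      have e1 : w - proj w z = (1 - inner ℂ w z / (‖w‖ : ℂ) ^ 2) • w := by
        rw [proj, sub_smul, one_smul]
      rw [inner_neg_right, ← Complex.coe_smul, inner_smul_right, e1, inner_smul_left, horth]
      simp
    have := norm_add_sq_eq_norm_sq_add_norm_sq_of_inner_eq_zero (𝕜 := ℂ) _ _ e0
    rw [← sub_eq_add_neg, norm_neg, norm_smul, Real.norm_of_nonneg (Real.sqrt_nonneg _)] at this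
    rw [sq, this]
    nlinarith [Real.mul_self_sqrt hs]
  rw [h3, h1, h2]
  field_simp
  ring

/-! ### Size of the radial Green function -/

lemma lintegral_Ioo_ofReal_of_hasDerivAt {F f : ℝ → ℝ} {a b : ℝ} (hab : a ≤ b)
    (hF : ∀ t ∈ Set.Icc a b, HasDerivAt F (f t) t) (hf : ContinuousOn f (Set.Icc a b))
    (h0 : ∀ t ∈ Set.Icc a b, 0 ≤ f t) :
    ∫⁻ t in Set.Ioo a b, ENNReal.ofReal (f t) = ENNReal.ofReal (F b - F a) := by
  have hint : IntervalIntegrable f volume a b := by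
    apply ContinuousOn.intervalIntegrable; rwa [Set.uIcc_of_le hab]
  have h1 := intervalIntegral.integral_eq_sub_of_hasDerivAt (f := F) (f' := f) (a := a) (b := b)
    (by rwa [Set.uIcc_of_le hab]) hint
  rw [← h1, intervalIntegral.integral_of_le hab, integral_Ioc_eq_integral_Ioo,
    ofReal_integral_eq_lintegral_ofReal]
  · exact ((intervalIntegrable_iff_integrableOn_Ioo_of_le hab).mp hint)
  · exact (ae_restrict_mem measurableSet_Ioo).mono fun t ht => h0 t ⟨ht.1.le, ht.2.le⟩

lemma lintegral_one_sub_sq_pow_mul (m : ℕ) {x : ℝ} (hx0 : 0 ≤ x) (hx : x ≤ 1) :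
    ∫⁻ t in Set.Ioo x 1, ENNReal.ofReal ((1 - t ^ 2) ^ m * t) =
      ENNReal.ofReal ((1 - x ^ 2) ^ (m + 1) / (2 * (m + 1))) := by
  rw [lintegral_Ioo_ofReal_of_hasDerivAt (F := fun t : ℝ => -(1 - t ^ 2) ^ (m + 1) / (2 * (m + 1))) hx]
  · congr 1; simp; ring
  · intro t _
    have h := ((((hasDerivAt_id t).pow 2).const_sub 1).pow (m + 1)).neg.div_const
      (2 * ((m : ℝ) + 1))
    refine h.congr_deriv ?_
    have : (m : ℝ) + 1 ≠ 0 := by positivity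
    simp
    field_simp
  · fun_prop
  · intro t ht
    have h1 : 0 ≤ t := hx0.trans ht.1
    have : 0 ≤ 1 - t ^ 2 := by nlinarith [ht.2]
    positivity

lemma lintegral_zpow_le (m : ℕ) (hm : 0 < m) {x : ℝ} (hx0 : 0 < x) (hx : x ≤ 1) :
    ∫⁻ t in Set.Ioo x 1, ENNReal.ofReal (t ^ (-2 * (m : ℤ) - 1)) ≤
      ENNReal.ofReal ((x ^ (2 * m))⁻¹) := by
  have hm1 : (1 : ℝ) ≤ m := by exact_mod_cast hm
  rw [lintegral_Ioo_ofReal_of_hasDerivAt (F := fun t => -(t ^ (-2 * (m : ℤ))) / (2 * m)) hx]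
  · apply ENNReal.ofReal_le_ofReal
    have e : x ^ (-2 * (m : ℤ)) = (x ^ (2 * m))⁻¹ := by
      rw [← zpow_natCast, ← zpow_neg]; congr 1
    simp only [one_zpow, e]
    have h0 : 0 ≤ (x ^ (2 * m))⁻¹ := by positivity
    have h1 : (x ^ (2 * m))⁻¹ / (2 * m) ≤ (x ^ (2 * m))⁻¹ :=
      div_le_self h0 (by linarith)
    have h2 : (0 : ℝ) ≤ 1 / (2 * m) := by positivity
    have h3 : -1 / (2 * (m : ℝ)) - -(x ^ (2 * m))⁻¹ / (2 * m) =
        (x ^ (2 * m))⁻¹ / (2 * m) - 1 / (2 * m) := by ring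
    linarith
  · intro t ht
    have ht0 : t ≠ 0 := (hx0.trans_le ht.1).ne'
    refine ((hasDerivAt_zpow (-2 * (m : ℤ)) t (Or.inl ht0)).neg.div_const _).congr_deriv ?_
    push_cast
    field_simp
  · intro t ht
    exact (continuousAt_zpow₀ _ _ (Or.inl (hx0.trans_le ht.1).ne')).continuousWithinAt
  · intro t ht
    have : 0 < t := hx0.trans_le ht.1
    positivity

lemma exists_le_g (n : ℕ) (hn : 1 < n) : ∃ c : ℝ, 0 < c ∧ ∀ z : Cn n, ‖z‖ ≤ 1 →
    ENNReal.ofReal (c * (1 - ‖z‖ ^ 2) ^ n) ≤ g z := by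
  obtain ⟨m, rfl⟩ : ∃ m, n = m + 1 := ⟨n - 1, by omega⟩
  refine ⟨(((m + 1 : ℕ) : ℝ) + 1) / (2 * (m + 1 : ℕ)) * (1 / (2 * (m + 1))), by positivity,
    fun z hz => ?_⟩
  rw [g, mul_assoc, ENNReal.ofReal_mul (by positivity), one_div_mul_eq_div,
    ← lintegral_one_sub_sq_pow_mul m (norm_nonneg z) hz]
  refine mul_le_mul_right ?_ _
  refine setLIntegral_mono' measurableSet_Ioo fun t ht => ENNReal.ofReal_le_ofReal ?_
  have ht0 : 0 < t := (norm_nonneg z).trans_lt ht.1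
  have h1 : 0 ≤ 1 - t ^ 2 := by nlinarith [ht.2]
  have e1 : ((m + 1 : ℕ) : ℤ) - 1 = m := by push_cast; ring
  rw [e1, zpow_natCast]
  gcongr
  have e2 : t ^ (-2 * ((m + 1 : ℕ) : ℤ) + 1) = (t ^ (2 * m + 1))⁻¹ := by
    rw [← zpow_natCast, ← zpow_neg]; congr 1
  rw [e2]
  exact ht.2.le.trans ((one_le_inv₀ (by positivity : 0 < t ^ (2 * m + 1))).mpr (pow_le_one₀ ht0.le ht.2.le))

lemma exists_g_le_of_le (n : ℕ) (hn : 1 < n) (ε : ℝ) (hε : 0 < ε) : ∃ C : ℝ, 0 < C ∧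
    ∀ z : Cn n, ε ≤ ‖z‖ → ‖z‖ ≤ 1 → g z ≤ ENNReal.ofReal (C * (1 - ‖z‖ ^ 2) ^ n) := by
  obtain ⟨m, rfl⟩ : ∃ m, n = m + 1 := ⟨n - 1, by omega⟩
  refine ⟨(((m + 1 : ℕ) : ℝ) + 1) / (2 * (m + 1 : ℕ)) *
    ((ε ^ (2 * m + 2))⁻¹ * (1 / (2 * (m + 1)))), by positivity, fun z hz0 hz => ?_⟩
  rw [g, mul_assoc, ENNReal.ofReal_mul (by positivity), mul_assoc, one_div_mul_eq_div,
    ENNReal.ofReal_mul (by positivity), ← lintegral_one_sub_sq_pow_mul m (norm_nonneg z) hz,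
    ← lintegral_const_mul' (ENNReal.ofReal (ε ^ (2 * m + 2))⁻¹) _ ENNReal.ofReal_ne_top]
  refine mul_le_mul_right ?_ _
  refine setLIntegral_mono' measurableSet_Ioo fun t ht => ?_
  rw [← ENNReal.ofReal_mul (by positivity)]
  refine ENNReal.ofReal_le_ofReal ?_
  have ht0 : 0 < t := (norm_nonneg z).trans_lt ht.1
  have h1 : 0 ≤ 1 - t ^ 2 := by nlinarith [ht.2]
  have e1 : ((m + 1 : ℕ) : ℤ) - 1 = m := by push_cast; ring
  rw [e1, zpow_natCast]
  have e2 : t ^ (-2 * ((m + 1 : ℕ) : ℤ) + 1) = (t ^ (2 * m + 2))⁻¹ * t := by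
    rw [← zpow_natCast, ← zpow_neg, ← zpow_add_one₀ ht0.ne']; congr 1
  have e3 : (t ^ (2 * m + 2))⁻¹ ≤ (ε ^ (2 * m + 2))⁻¹ := by
    gcongr; exact hz0.trans ht.1.le
  rw [e2, mul_left_comm]
  gcongr

lemma exists_g_le (n : ℕ) (hn : 1 < n) : ∃ C : ℝ, 0 < C ∧
    ∀ z : Cn n, z ≠ 0 → ‖z‖ ≤ 1 → g z ≤ ENNReal.ofReal (C * (‖z‖ ^ (2 * (n - 1)))⁻¹) := by
  obtain ⟨m, rfl⟩ : ∃ m, n = m + 1 := ⟨n - 1, by omega⟩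
  refine ⟨(((m + 1 : ℕ) : ℝ) + 1) / (2 * (m + 1 : ℕ)), by positivity, fun z hz0 hz => ?_⟩
  rw [g, ENNReal.ofReal_mul (by positivity), Nat.add_sub_cancel]
  refine mul_le_mul_right ?_ _
  refine le_trans ?_ (lintegral_zpow_le m (by omega) (norm_pos_iff.mpr hz0) hz)
  refine setLIntegral_mono' measurableSet_Ioo fun t ht => ENNReal.ofReal_le_ofReal ?_
  have ht0 : 0 < t := (norm_nonneg z).trans_lt ht.1
  have h1 : 0 ≤ 1 - t ^ 2 := by nlinarith [ht.2]
  have e1 : ((m + 1 : ℕ) : ℤ) - 1 = m := by push_cast; ring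
  have e2 : -2 * ((m + 1 : ℕ) : ℤ) + 1 = -2 * (m : ℤ) - 1 := by push_cast; ring
  rw [e1, zpow_natCast, e2]
  exact mul_le_of_le_one_left (by positivity) (pow_le_one₀ h1 (by nlinarith))

/-! ### Measures of anisotropic boxes on the sphere -/

open scoped Pointwise

lemma exists_volume_box (n : ℕ) : ∃ c : ℝ≥0∞, c ≠ 0 ∧ c ≠ ∞ ∧ ∀ s : Fin n → Set ℂ,
    volume {z : Cn n | ∀ j, z j ∈ s j} = c * ∏ j, volume (s j) := by
  let e := EuclideanSpace.equiv (Fin n) ℂ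
  have : ((volume : Measure (Cn n)).map e).IsAddHaarMeasure := e.isAddHaarMeasure_map _
  have h := Measure.isAddLeftInvariant_eq_smul
    ((volume : Measure (Cn n)).map e) (volume : Measure (Fin n → ℂ))
  refine ⟨_, ENNReal.coe_ne_zero.mpr
    (Measure.addHaarScalarFactor_pos_of_isAddHaarMeasure ((volume : Measure (Cn n)).map e)
      (volume : Measure (Fin n → ℂ))).ne', ENNReal.coe_ne_top, fun s => ?_⟩
  have h1 : {z : Cn n | ∀ j, z j ∈ s j} = e ⁻¹' (Set.univ.pi s) := by
    ext z; simp [e]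
  have h2 := e.toHomeomorph.toMeasurableEquiv.map_apply (μ := volume) (Set.univ.pi s)
  rw [h1, ← volume_pi_pi, ← Measure.coe_nnreal_smul_apply, ← h]
  exact h2.symm

lemma volume_complex_box (a b c d : ℝ) :
    volume {z : ℂ | z.re ∈ Set.Icc a b ∧ z.im ∈ Set.Icc c d} =
      ENNReal.ofReal (b - a) * ENNReal.ofReal (d - c) := by
  have := Complex.volume_preserving_equiv_real_prod.measure_preimage_equiv
    (Set.Icc a b ×ˢ Set.Icc c d)
  rw [Measure.volume_eq_prod, Measure.prod_prod, Real.volume_Icc, Real.volume_Icc] at this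
  exact this

/-- The product of a rectangle in the first coordinate and discs in the other coordinates. -/
def box (m : ℕ) (a b y R : ℝ) : Set (Cn (m + 1)) :=
  {z | ((z 0).re ∈ Set.Icc a b ∧ (z 0).im ∈ Set.Icc (-y) y) ∧
    ∀ j : Fin m, z j.succ ∈ Metric.closedBall 0 R}

lemma exists_volume_box_eq (m : ℕ) : ∃ c : ℝ, 0 < c ∧ ∀ a b y R : ℝ, a ≤ b → 0 ≤ y → 0 ≤ R →
    volume (box m a b y R) = ENNReal.ofReal (c * ((b - a) * y * R ^ (2 * m))) := by
  obtain ⟨c, hc0, hc, h⟩ := exists_volume_box (m + 1)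
  refine ⟨c.toReal * (2 * Real.pi ^ m), mul_pos (ENNReal.toReal_pos hc0 hc) (by positivity),
    fun a b y R hab hy hR => ?_⟩
  have h1 := h (Fin.cons {z : ℂ | z.re ∈ Set.Icc a b ∧ z.im ∈ Set.Icc (-y) y}
    fun _ => Metric.closedBall 0 R)
  have h2 : box m a b y R = {z : Cn (m + 1) | ∀ j, z j ∈
      (Fin.cons {z : ℂ | z.re ∈ Set.Icc a b ∧ z.im ∈ Set.Icc (-y) y}
    fun _ => Metric.closedBall 0 R : Fin (m + 1) → Set ℂ) j} := by
    ext z; simp [box, Fin.forall_fin_succ]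
  rw [h2, h1, Fin.prod_univ_succ]
  simp only [Fin.cons_zero, Fin.cons_succ, volume_complex_box, Complex.volume_closedBall,
    Finset.prod_const, Finset.card_univ, Fintype.card_fin]
  rw [← ENNReal.ofReal_toReal hc]
  have hpi : (NNReal.pi : ℝ≥0∞) = ENNReal.ofReal Real.pi := by
    rw [ENNReal.ofReal, ← NNReal.coe_real_pi, Real.toNNReal_coe]
  have hba : 0 ≤ b - a := by linarith
  rw [hpi, ← ENNReal.ofReal_pow hR, ← ENNReal.ofReal_mul (sq_nonneg R),
    ← ENNReal.ofReal_mul hba, ← ENNReal.ofReal_pow (by positivity),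
    ← ENNReal.ofReal_mul (mul_nonneg hba (by linarith)), ENNReal.toReal_ofReal ENNReal.toReal_nonneg,
    ← ENNReal.ofReal_mul ENNReal.toReal_nonneg]
  congr 1
  rw [pow_mul, mul_pow]
  ring

/-- Every unit vector can be rotated to the first basis vector, preserving volume. -/
lemma exists_measurePreserving_rotation {m : ℕ} (η : S (m + 1)) :
    ∃ L : Cn (m + 1) ≃ₗᵢ[ℂ] Cn (m + 1), (∀ z, L z 0 = inner ℂ (η : Cn (m + 1)) z) ∧
      ∀ s, volume (L ⁻¹' s) = volume s := by
  obtain ⟨b, hb⟩ := Orthonormal.exists_orthonormalBasis_extension_of_card_eq (𝕜 := ℂ)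
    (E := Cn (m + 1)) (ι := Fin (m + 1)) (by simp) (v := fun _ => (η : Cn (m + 1))) (s := {0}) (by
      refine ⟨fun i => by simp, fun i j hij => ?_⟩
      exact absurd (Subsingleton.elim i j) hij)
  refine ⟨b.repr, fun z => ?_, fun s => ?_⟩
  · rw [b.repr_apply_apply, hb 0 rfl]
  · let LR : Cn (m + 1) ≃ₗᵢ[ℝ] Cn (m + 1) :=
      { b.repr.toLinearEquiv.restrictScalars ℝ with norm_map' := b.repr.norm_map }
    exact LR.measurePreserving.measure_preimage_equiv
      (f := LR.toHomeomorph.toMeasurableEquiv) s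

lemma exists_sigma_eq (n : ℕ) (hn : 0 < n) : ∃ c : ℝ, 0 < c ∧ ∀ s : Set (S n),
    MeasurableSet s → sigma n s =
      ENNReal.ofReal c * volume (Set.Ioo (0 : ℝ) 1 • ((↑) '' s : Set (Cn n))) := by
  have : Nonempty (Fin n) := ⟨⟨0, hn⟩⟩
  have h0 : (volume : Measure (Cn n)).toSphere Set.univ ≠ 0 := by
    rw [Measure.measure_univ_ne_zero]; exact Measure.toSphere_ne_zero _
  have h1 : (volume : Measure (Cn n)).toSphere Set.univ ≠ ∞ := measure_ne_top _ _
  have h2 : ((volume : Measure (Cn n)).toSphere Set.univ)⁻¹ * (Module.finrank ℝ (Cn n) : ℝ≥0∞)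
      ≠ ∞ := ENNReal.mul_ne_top (ENNReal.inv_ne_top.mpr h0) (ENNReal.natCast_ne_top _)
  refine ⟨(((volume : Measure (Cn n)).toSphere Set.univ)⁻¹ *
    (Module.finrank ℝ (Cn n) : ℝ≥0∞)).toReal, ENNReal.toReal_pos ?_ h2, fun s hs => ?_⟩
  · refine mul_ne_zero (ENNReal.inv_ne_zero.mpr h1) ?_
    exact_mod_cast Module.finrank_pos.ne'
  · rw [ENNReal.ofReal_toReal h2, sigma, Measure.smul_apply, Measure.toSphere_apply' _ hs,
      smul_eq_mul, mul_assoc]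

lemma sigma_univ_le_one (n : ℕ) : sigma n Set.univ ≤ 1 := by
  rw [sigma, Measure.smul_apply, smul_eq_mul]
  exact ENNReal.inv_mul_le_one _

instance instIsFiniteMeasureSigma (n : ℕ) : IsFiniteMeasure (sigma n) :=
  ⟨(sigma_univ_le_one n).trans_lt ENNReal.one_lt_top⟩

lemma norm_sq_eq_succ {m : ℕ} (z : Cn (m + 1)) :
    ‖z‖ ^ 2 = (z 0).re ^ 2 + (z 0).im ^ 2 + ∑ j : Fin m, ‖z j.succ‖ ^ 2 := by
  rw [EuclideanSpace.norm_sq_eq, Fin.sum_univ_succ, Complex.sq_norm, Complex.normSq_apply]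
  ring

/-- The cone over an anisotropic box of the sphere lies in a box, up to rotation. -/
lemma exists_sigma_box_le (m : ℕ) : ∃ C : ℝ, 0 < C ∧ ∀ (η : S (m + 1)) (x y : ℝ), 0 ≤ x → 0 ≤ y →
    sigma (m + 1) {ξ | 1 - (inner ℂ (η : Cn (m + 1)) (ξ : Cn (m + 1))).re ≤ x ∧
      |(inner ℂ (η : Cn (m + 1)) (ξ : Cn (m + 1))).im| ≤ y} ≤
      ENNReal.ofReal (C * (x ^ m * y)) := by
  obtain ⟨c, hc, hσ⟩ := exists_sigma_eq (m + 1) (by omega)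
  obtain ⟨b, hb, hbox⟩ := exists_volume_box_eq m
  refine ⟨c * (b * (2 * 2 ^ m)), by positivity, fun η x y hx hy => ?_⟩
  obtain ⟨L, hL0, hLv⟩ := exists_measurePreserving_rotation η
  rw [hσ]
  swap
  · exact ((isClosed_le (f := fun ξ : S (m + 1) =>
      1 - (inner ℂ (η : Cn (m + 1)) (ξ : Cn (m + 1))).re) (by fun_prop) continuous_const).inter
      (isClosed_le (f := fun ξ : S (m + 1) =>
        |(inner ℂ (η : Cn (m + 1)) (ξ : Cn (m + 1))).im|)
        (by fun_prop) continuous_const)).measurableSet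
  have hsub : Set.Ioo (0 : ℝ) 1 • ((↑) '' {ξ : S (m + 1) |
      1 - (inner ℂ (η : Cn (m + 1)) (ξ : Cn (m + 1))).re ≤ x ∧
      |(inner ℂ (η : Cn (m + 1)) (ξ : Cn (m + 1))).im| ≤ y} : Set (Cn (m + 1))) ⊆
      L ⁻¹' (box m (-1) 1 y (Real.sqrt (2 * x))) := by
    rintro _ ⟨t, ⟨ht0, ht1⟩, _, ⟨ξ, ⟨h1, h2⟩, rfl⟩, rfl⟩
    have hξ : ‖(ξ : Cn (m + 1))‖ = 1 := by simp
    rw [← hL0] at h1 h2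
    have hn := norm_sq_eq_succ (L (ξ : Cn (m + 1)))
    rw [L.norm_map, hξ] at hn
    have hLt : L (t • (ξ : Cn (m + 1))) = t • L ξ := by
      rw [← Complex.coe_smul, map_smul, Complex.coe_smul]
    set v := L (ξ : Cn (m + 1))
    have hsum : 0 ≤ ∑ j : Fin m, ‖v j.succ‖ ^ 2 := Finset.sum_nonneg fun _ _ => by positivity
    have hre : |(v 0).re| ≤ 1 := by
      rw [← sq_le_one_iff_abs_le_one]; nlinarith [sq_nonneg (v 0).im]
    have hmul : ∀ u : ℝ, |t * u| ≤ |u| := fun u => by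
      rw [abs_mul, abs_of_pos ht0]; exact mul_le_of_le_one_left (abs_nonneg _) ht1.le
    simp only [Set.mem_preimage, hLt, box, Set.mem_ofPred_eq, PiLp.smul_apply, Complex.smul_re,
      Complex.smul_im, smul_eq_mul, Set.mem_Icc, ← abs_le, mem_closedBall_zero_iff]
    refine ⟨⟨(hmul _).trans hre, (hmul _).trans h2⟩, fun j => ?_⟩
    rw [norm_smul, Real.norm_of_nonneg ht0.le]
    refine (mul_le_of_le_one_left (norm_nonneg _) ht1.le).trans (Real.le_sqrt_of_sq_le ?_)
    have hj : ‖v j.succ‖ ^ 2 ≤ ∑ j : Fin m, ‖v j.succ‖ ^ 2 :=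
      Finset.single_le_sum (f := fun j : Fin m => ‖v j.succ‖ ^ 2) (fun _ _ => by positivity)
        (Finset.mem_univ j)
    nlinarith [sq_nonneg (v 0).im, (abs_le.mp hre).2, (abs_le.mp hre).1]
  refine (mul_le_mul_right (measure_mono hsub) _).trans ?_
  rw [hLv, hbox _ _ _ _ (by norm_num) hy (Real.sqrt_nonneg _), ← ENNReal.ofReal_mul hc.le]
  refine ENNReal.ofReal_le_ofReal (le_of_eq ?_)
  rw [pow_mul, Real.sq_sqrt (by positivity)]
  ring

/-- A cone over an anisotropic ball of the sphere contains a box, up to rotation. -/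
lemma exists_le_sigma_ball (m : ℕ) : ∃ c : ℝ, 0 < c ∧ ∀ (η : S (m + 1)) (h : ℝ), 0 < h → h ≤ 1 →
    ENNReal.ofReal (c * h ^ (m + 1)) ≤
      sigma (m + 1) {ξ | ‖1 - inner ℂ (η : Cn (m + 1)) (ξ : Cn (m + 1))‖ < h} := by
  obtain ⟨c, hc, hσ⟩ := exists_sigma_eq (m + 1) (by omega)
  obtain ⟨b, hb, hbox⟩ := exists_volume_box_eq m
  refine ⟨c * (b * (1 / 32 * (1 / (8 * (m + 1))) ^ m)), by positivity, fun η h h0 h1 => ?_⟩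
  obtain ⟨L, hL0, hLv⟩ := exists_measurePreserving_rotation η
  rw [hσ _ (isOpen_lt (by fun_prop) (by fun_prop)).measurableSet]
  have hsub : L ⁻¹' (box m (1 / 2) (3 / 4) (h / 8) (Real.sqrt (h / (8 * (m + 1))))) ⊆
      Set.Ioo (0 : ℝ) 1 • ((↑) '' {ξ : S (m + 1) |
        ‖1 - inner ℂ (η : Cn (m + 1)) (ξ : Cn (m + 1))‖ < h} : Set (Cn (m + 1))) := by
    rintro z ⟨⟨⟨hx1, hx2⟩, hy⟩, hR⟩
    have hn := norm_sq_eq_succ (L z)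
    rw [L.norm_map] at hn
    have hsum : ∑ j : Fin m, ‖(L z) j.succ‖ ^ 2 ≤ h / 8 := by
      calc ∑ j : Fin m, ‖(L z) j.succ‖ ^ 2 ≤ ∑ j : Fin m, h / (8 * (m + 1)) := by
            refine Finset.sum_le_sum fun j _ => ?_
            rw [← Real.sq_sqrt (by positivity : 0 ≤ h / (8 * ((m : ℝ) + 1)))]
            have := mem_closedBall_zero_iff.mp (hR j)
            gcongr
        _ = (m / (m + 1)) * (h / 8) := by simp; field_simp
        _ ≤ h / 8 := mul_le_of_le_one_left (by positivity)
            ((div_le_one (by positivity)).mpr (by linarith))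
    have hsum0 : 0 ≤ ∑ j : Fin m, ‖(L z) j.succ‖ ^ 2 := Finset.sum_nonneg fun _ _ => by positivity
    have hy' := abs_le.mpr hy
    have hy2 : ((L z) 0).im ^ 2 ≤ (h / 8) ^ 2 := by rw [← sq_abs]; gcongr
    have hzge : ((L z) 0).re ≤ ‖z‖ := by
      apply le_of_sq_le_sq _ (norm_nonneg z)
      nlinarith [sq_nonneg ((L z) 0).im]
    have hz0 : 0 < ‖z‖ := by linarith
    have hz1 : ‖z‖ < 1 := by nlinarith
    have hξ : (‖z‖⁻¹ • z) ∈ Metric.sphere (0 : Cn (m + 1)) 1 := by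
      rw [mem_sphere_zero_iff_norm, norm_smul, norm_inv, norm_norm, inv_mul_cancel₀ hz0.ne']
    refine ⟨‖z‖, ⟨hz0, hz1⟩, ‖z‖⁻¹ • z, ⟨⟨_, hξ⟩, ?_, rfl⟩, ?_⟩
    · simp only [Set.mem_ofPred_eq]
      rw [← Complex.coe_smul, inner_smul_right, ← hL0]
      have e : 1 - ((‖z‖⁻¹ : ℝ) : ℂ) * (L z) 0 = ((‖z‖⁻¹ : ℝ) : ℂ) * (‖z‖ - (L z) 0) := by
        have : (‖z‖ : ℂ) ≠ 0 := by exact_mod_cast hz0.ne'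
        push_cast; field_simp
      rw [e, norm_mul, Complex.norm_real, Real.norm_of_nonneg (by positivity),
        inv_mul_lt_iff₀ hz0]
      have e2 := Complex.norm_le_abs_re_add_abs_im ((‖z‖ : ℂ) - (L z) 0)
      simp only [Complex.sub_re, Complex.ofReal_re, Complex.sub_im, Complex.ofReal_im, zero_sub,
        abs_neg] at e2
      rw [abs_of_nonneg (by linarith : 0 ≤ ‖z‖ - ((L z) 0).re)] at e2
      have e3 : ‖z‖ - ((L z) 0).re ≤ ((L z) 0).im ^ 2 + ∑ j : Fin m, ‖(L z) j.succ‖ ^ 2 := by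
        nlinarith
      nlinarith
    · exact smul_inv_smul₀ hz0.ne' z
  refine le_trans ?_ (mul_le_mul_right (measure_mono hsub) _)
  rw [hLv, hbox _ _ _ _ (by norm_num) (by positivity) (Real.sqrt_nonneg _),
    ← ENNReal.ofReal_mul hc.le]
  refine ENNReal.ofReal_le_ofReal (le_of_eq ?_)
  rw [pow_mul, Real.sq_sqrt (by positivity), div_pow, div_pow]
  field_simp
  ring

/-! ### Averages of measures of slices -/

/-- A comparison of `L^p` means of measures of slices. The exponent is split as `p = 1 + (p - 1)`:
the factor of exponent `p - 1` is bounded by a function of `y` alone, so that Tonelli's theorem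
reduces the comparison of the means over `E` and over `F` to that of the dual slices. -/
lemma lintegral_measure_slice_rpow_le {X Y : Type*} [MeasurableSpace X] [MeasurableSpace Y]
    {σ : Measure X} {μ : Measure Y} [SFinite σ] [SFinite μ] {p : ℝ} (hp : 1 < p)
    {E F : Set (X × Y)} (hE : MeasurableSet E) (hF : MeasurableSet F)
    {U : Set (Y × Y)} (hU : MeasurableSet U) (G : X → Set Y) (C : ℝ≥0∞) (hC : C ≠ ∞)
    (hEU : ∀ x y y', (x, y) ∈ E → (x, y') ∈ E → (y, y') ∈ U)
    (hEF : ∀ y, σ {x | (x, y) ∈ E} ≤ C * σ {x | (x, y) ∈ F})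
    (hFG : ∀ x y, (x, y) ∈ F → y ∈ G x)
    (hFU : ∀ x y y', (x, y) ∈ F → (y, y') ∈ U → y' ∈ G x) :
    ∫⁻ x, μ {y | (x, y) ∈ E} ^ p ∂σ ≤ C * ∫⁻ x, μ (G x) ^ p ∂σ := by
  have hp1 : 0 ≤ p - 1 := by linarith
  have hsplit : ∀ a : ℝ≥0∞, a ^ p = a ^ (p - 1) * a := fun a => by
    conv_lhs => rw [← sub_add_cancel p 1, ENNReal.rpow_add_of_nonneg _ _ hp1 zero_le_one,
      ENNReal.rpow_one]
  let V : Y → ℝ≥0∞ := fun y => μ {y' | (y, y') ∈ U} ^ (p - 1)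
  have hV : Measurable V := (measurable_measure_prodMk_left hU).pow_const _
  have hslice : ∀ {A : Set (X × Y)}, MeasurableSet A → ∀ x, MeasurableSet {y | (x, y) ∈ A} :=
    fun hA x => measurable_prodMk_left hA
  have hslice' : ∀ {A : Set (X × Y)}, MeasurableSet A → ∀ y, MeasurableSet {x | (x, y) ∈ A} :=
    fun hA y => measurable_prodMk_right hA
  have hswap : ∀ {A : Set (X × Y)}, MeasurableSet A →
      ∫⁻ x, ∫⁻ y in {y | (x, y) ∈ A}, V y ∂μ ∂σ = ∫⁻ y, V y * σ {x | (x, y) ∈ A} ∂μ := by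
    intro A hA
    have h1 : ∀ x, ∫⁻ y in {y | (x, y) ∈ A}, V y ∂μ =
        ∫⁻ y, A.indicator (fun q => V q.2) (x, y) ∂μ := fun x => by
      rw [← lintegral_indicator (hslice hA x)]; rfl
    simp_rw [h1]
    rw [lintegral_lintegral_swap]
    · refine lintegral_congr fun y => ?_
      rw [← setLIntegral_const, ← lintegral_indicator (hslice' hA y)]; rfl
    · exact ((hV.comp measurable_snd).indicator hA).aemeasurable
  calc ∫⁻ x, μ {y | (x, y) ∈ E} ^ p ∂σ
      ≤ ∫⁻ x, ∫⁻ y in {y | (x, y) ∈ E}, V y ∂μ ∂σ := by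
        refine lintegral_mono fun x => ?_
        rw [hsplit, ← setLIntegral_const]
        refine setLIntegral_mono' (hslice hE x) fun y hy => ?_
        exact ENNReal.rpow_le_rpow (measure_mono fun y' hy' => hEU x y y' hy hy') hp1
    _ = ∫⁻ y, V y * σ {x | (x, y) ∈ E} ∂μ := hswap hE
    _ ≤ ∫⁻ y, C * (V y * σ {x | (x, y) ∈ F}) ∂μ := by
        refine lintegral_mono fun y => ?_
        rw [mul_left_comm]
        exact mul_le_mul_right (hEF y) _
    _ = C * ∫⁻ x, ∫⁻ y in {y | (x, y) ∈ F}, V y ∂μ ∂σ := by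
        rw [lintegral_const_mul' _ _ hC, hswap hF]
    _ ≤ C * ∫⁻ x, μ (G x) ^ p ∂σ := by
        refine mul_le_mul_right (lintegral_mono fun x => ?_) _
        rw [hsplit]
        refine (setLIntegral_mono' (hslice hF x) (g := fun _ => μ (G x) ^ (p - 1))
          fun y hy => ?_).trans ?_
        · exact ENNReal.rpow_le_rpow (measure_mono fun y' hy' => hFU x y y' hy hy') hp1
        · rw [setLIntegral_const]
          exact mul_le_mul_right (measure_mono fun y hy => hFG x y hy) _

lemma lintegral_Lp_const_mul {α : Type*} [MeasurableSpace α] {ν : Measure α} {p : ℝ} (hp : 0 < p)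
    {a : ℝ≥0∞} (ha : a ≠ ∞) (f : α → ℝ≥0∞) :
    (∫⁻ x, (a * f x) ^ p ∂ν) ^ (1 / p) = a * (∫⁻ x, f x ^ p ∂ν) ^ (1 / p) := by
  simp_rw [ENNReal.mul_rpow_of_nonneg _ _ hp.le]
  rw [lintegral_const_mul' _ _ (ENNReal.rpow_ne_top_of_nonneg hp.le ha),
    ENNReal.mul_rpow_of_nonneg _ _ (by positivity), ← ENNReal.rpow_mul, mul_one_div_cancel hp.ne',
    ENNReal.rpow_one]

/-! ### Pseudo-hyperbolic balls -/

lemma norm_phi_sq {n : ℕ} {w z : Cn n} (hw : ‖w‖ ≤ 1) (h : 0 < ‖1 - inner ℂ w z‖) :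
    ‖phi w z‖ ^ 2 = 1 - (1 - ‖w‖ ^ 2) * (1 - ‖z‖ ^ 2) / ‖1 - inner ℂ w z‖ ^ 2 := by
  have := norm_phi_sq_mul hw (norm_pos_iff.mp h)
  field_simp
  linarith

/-- The closed pseudo-hyperbolic ball `{w : |φ_w(z)| ≤ τ}`, with denominators cleared. -/
def pseudoBall {n : ℕ} (z : Cn n) (τ : ℝ) : Set (B n) :=
  {w | ‖1 - inner ℂ (w : Cn n) z‖ ^ 2 - (1 - ‖(w : Cn n)‖ ^ 2) * (1 - ‖z‖ ^ 2) ≤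
    τ ^ 2 * ‖1 - inner ℂ (w : Cn n) z‖ ^ 2}

lemma mem_pseudoBall {n : ℕ} {z : Cn n} {τ : ℝ} (hτ : 0 ≤ τ) {w : B n}
    (h : 0 < ‖1 - inner ℂ (w : Cn n) z‖) : w ∈ pseudoBall z τ ↔ ‖phi (w : Cn n) z‖ ≤ τ := by
  have hw : ‖(w : Cn n)‖ ≤ 1 := (mem_ball_zero_iff.mp w.2).le
  rw [pseudoBall, Set.mem_ofPred_eq, ← norm_phi_sq_mul hw (norm_pos_iff.mp h),
    mul_le_mul_iff_of_pos_right (by positivity), sq_le_sq₀ (norm_nonneg _) hτ]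

lemma measurableSet_pseudoBall_prod (n : ℕ) (r τ : ℝ) :
    MeasurableSet {q : S n × B n | q.2 ∈ pseudoBall (r • (q.1 : Cn n)) τ} :=
  (isClosed_le (f := fun q : S n × B n => ‖1 - inner ℂ (q.2 : Cn n) (r • (q.1 : Cn n))‖ ^ 2 -
    (1 - ‖(q.2 : Cn n)‖ ^ 2) * (1 - ‖r • (q.1 : Cn n)‖ ^ 2)) (by fun_prop)
    (by fun_prop)).measurableSet

lemma mem_carleson {n : ℕ} {ξ : S n} {δ : ℝ} {w : B n} :
    w ∈ carleson ξ δ ↔ ‖1 - inner ℂ (w : Cn n) (ξ : Cn n)‖ < δ := by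
  rw [carleson, Set.mem_ofPred_eq, anisoDist, Real.sqrt_lt_sqrt_iff (norm_nonneg _),
    norm_one_sub_inner_comm]

lemma measurableSet_carleson_prod (n : ℕ) (δ : ℝ) :
    MeasurableSet {q : S n × B n | q.2 ∈ carleson q.1 δ} := by
  simp_rw [mem_carleson]
  exact (isOpen_lt (by fun_prop) (by fun_prop)).measurableSet

lemma measurableSet_carleson {n : ℕ} (ξ : S n) (δ : ℝ) : MeasurableSet (carleson ξ δ) :=
  measurable_prodMk_left (measurableSet_carleson_prod n δ)

lemma measurableSet_pseudoBall {n : ℕ} (ξ : S n) (r τ : ℝ) :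
    MeasurableSet (pseudoBall (r • (ξ : Cn n)) τ) :=
  measurable_prodMk_left (measurableSet_pseudoBall_prod n r τ)

/-- Points close to `rξ` lie in an annulus of width comparable to `1 - r`, and in an anisotropic
ball about `ξ` of comparable size. -/
lemma bounds_of_mem_pseudoBall {n : ℕ} {ξ : S n} {r τ : ℝ} {w : B n} (hr0 : 0 ≤ r) (hr : r < 1)
    (hτ : τ ^ 2 ≤ 1 / 2) (hw : w ∈ pseudoBall (r • (ξ : Cn n)) τ) :
    (1 - r) / 8 ≤ 1 - ‖(w : Cn n)‖ ∧ 1 - ‖(w : Cn n)‖ ≤ 8 * (1 - r) ∧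
      ‖1 - inner ℂ (w : Cn n) (r • (ξ : Cn n))‖ ≤ 8 * (1 - r) := by
  have hw1 : ‖(w : Cn n)‖ < 1 := mem_ball_zero_iff.mp w.2
  have hξ : ‖(ξ : Cn n)‖ = 1 := by simp
  have hz : ‖r • (ξ : Cn n)‖ = r := by rw [norm_smul, hξ, Real.norm_of_nonneg hr0, mul_one]
  rw [pseudoBall, Set.mem_ofPred_eq, hz] at hw
  have h1 : 1 - ‖(w : Cn n)‖ ≤ ‖1 - inner ℂ (w : Cn n) (r • (ξ : Cn n))‖ :=
    one_sub_norm_le_norm_one_sub_inner (by rw [hz]; exact hr.le)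
  have h2 := one_sub_le_norm_one_sub_inner_smul (a := (ξ : Cn n)) hξ.le hw1.le hr0
  set D := ‖1 - inner ℂ (w : Cn n) (r • (ξ : Cn n))‖
  set ρ := ‖(w : Cn n)‖
  have hρ : 0 ≤ ρ := norm_nonneg _
  have h3 : (1 - ρ ^ 2) * (1 - r ^ 2) ≤ 4 * ((1 - ρ) * (1 - r)) := by
    have : 0 ≤ (1 - ρ) * (1 - r) := mul_nonneg (by linarith) (by linarith)
    have h5 : (1 + ρ) * (1 + r) ≤ 4 := by nlinarith
    nlinarith
  have h4 : D ^ 2 ≤ 8 * ((1 - ρ) * (1 - r)) := by nlinarith [sq_nonneg D]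
  have hD : 0 < D := by linarith
  refine ⟨?_, ?_, ?_⟩
  · by_contra! hc
    nlinarith
  · nlinarith
  · nlinarith

/-- The set of `ξ` with `w` in the ball of radius `τ` about `rξ` lies in an anisotropic box of the
sphere with sides comparable to `τ²(1 - r)` and `τ(1 - r)`. The restriction on `τ` keeps `w` away
from the origin. -/
lemma exists_sigma_pseudoBall_le (m : ℕ) (r₀ : ℝ) (hr₀ : 0 < r₀) (hr₀' : r₀ < 1) :
    ∃ C : ℝ, 0 < C ∧ ∀ (r τ : ℝ) (w : B (m + 1)), r₀ ≤ r → r < 1 → 0 < τ → τ ≤ r₀ / 4 →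
      sigma (m + 1) {ξ | w ∈ pseudoBall (r • (ξ : Cn (m + 1))) τ} ≤
        ENNReal.ofReal (C * (τ ^ (2 * m + 1) * (1 - r) ^ (m + 1))) := by
  obtain ⟨C, hC, hbox⟩ := exists_sigma_box_le m
  refine ⟨C * ((64 / r₀ ^ 2) ^ m * (16 / r₀ ^ 2)), by positivity, fun r τ w hr hr1 hτ hτ' => ?_⟩
  have hw1 : ‖(w : Cn (m + 1))‖ < 1 := mem_ball_zero_iff.mp w.2
  have hh : 0 < 1 - r := by linarith
  have hr0 : 0 < r := by linarith
  -- The defining inequality of the pseudo-hyperbolic ball in the coordinates of `w`.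
  have hnear : ∀ ξ : S (m + 1), w ∈ pseudoBall (r • (ξ : Cn (m + 1))) τ →
      ‖1 - inner ℂ (w : Cn (m + 1)) (r • (ξ : Cn (m + 1)))‖ ≤ 2 ∧
      ‖1 - inner ℂ (w : Cn (m + 1)) (r • (ξ : Cn (m + 1)))‖ ^ 2 -
        (1 - ‖(w : Cn (m + 1))‖ ^ 2) * (1 - r ^ 2) ≤
      τ ^ 2 * ‖1 - inner ℂ (w : Cn (m + 1)) (r • (ξ : Cn (m + 1)))‖ ^ 2 ∧
      ‖1 - inner ℂ (w : Cn (m + 1)) (r • (ξ : Cn (m + 1)))‖ ≤ 8 * (1 - r) := by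
    intro ξ hξ
    have hξ1 : ‖(ξ : Cn (m + 1))‖ = 1 := by simp
    have hz : ‖r • (ξ : Cn (m + 1))‖ = r := by
      rw [norm_smul, hξ1, Real.norm_of_nonneg hr0.le, mul_one]
    refine ⟨?_, ?_, (bounds_of_mem_pseudoBall hr0.le hr1 (by nlinarith) hξ).2.2⟩
    · have h1 := norm_sub_le (1 : ℂ) (inner ℂ (w : Cn (m + 1)) (r • (ξ : Cn (m + 1))))
      have h2 := norm_inner_le_norm (𝕜 := ℂ) (w : Cn (m + 1)) (r • (ξ : Cn (m + 1)))
      rw [norm_one] at h1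
      rw [hz] at h2
      nlinarith [norm_nonneg (w : Cn (m + 1))]
    · rw [pseudoBall, Set.mem_ofPred_eq, hz] at hξ
      exact hξ
  rcases lt_or_ge ‖(w : Cn (m + 1))‖ (r₀ / 2) with hw0 | hw0
  · have : {ξ : S (m + 1) | w ∈ pseudoBall (r • (ξ : Cn (m + 1))) τ} = ∅ := by
      refine Set.eq_empty_of_forall_notMem fun ξ hξ => ?_
      obtain ⟨h1, h2, -⟩ := hnear ξ hξ
      have hξ1 : ‖(ξ : Cn (m + 1))‖ = 1 := by simp
      have h3 : 1 - ‖(w : Cn (m + 1))‖ * r ≤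
          ‖1 - inner ℂ (w : Cn (m + 1)) (r • (ξ : Cn (m + 1)))‖ := by
        have h1 := norm_sub_norm_le (1 : ℂ) (inner ℂ (w : Cn (m + 1)) (r • (ξ : Cn (m + 1))))
        have h2 := norm_inner_le_norm (𝕜 := ℂ) (w : Cn (m + 1)) (r • (ξ : Cn (m + 1)))
        rw [norm_smul, hξ1, Real.norm_of_nonneg hr0.le, mul_one] at h2
        rw [norm_one] at h1
        linarith
      set D := ‖1 - inner ℂ (w : Cn (m + 1)) (r • (ξ : Cn (m + 1)))‖
      set ρ := ‖(w : Cn (m + 1))‖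
      have hρ : 0 ≤ ρ := norm_nonneg _
      have hρr : 0 ≤ 1 - ρ * r := by nlinarith
      have h4 : (1 - ρ * r) ^ 2 ≤ D ^ 2 := by gcongr
      have h5 : (r₀ / 2) ^ 2 < (r - ρ) ^ 2 := by
        apply pow_lt_pow_left₀ _ (by positivity) two_ne_zero; linarith
      have h6 : τ ^ 2 * D ^ 2 ≤ (r₀ / 4) ^ 2 * 2 ^ 2 := by
        gcongr
      nlinarith
    rw [this, measure_empty]
    exact zero_le
  · set ρ := ‖(w : Cn (m + 1))‖
    have hρ0 : 0 < ρ := by linarith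
    have hη : (ρ⁻¹ • (w : Cn (m + 1))) ∈ Metric.sphere (0 : Cn (m + 1)) 1 := by
      rw [mem_sphere_zero_iff_norm, norm_smul, norm_inv, Real.norm_of_nonneg hρ0.le,
        inv_mul_cancel₀ hρ0.ne']
    refine (measure_mono fun ξ hξ => ?_).trans ((hbox ⟨_, hη⟩ (64 / r₀ ^ 2 * (τ ^ 2 * (1 - r)))
      (16 / r₀ ^ 2 * (τ * (1 - r))) (by positivity) (by positivity)).trans_eq ?_)
    · obtain ⟨-, h2, h3⟩ := hnear ξ hξ
      have hζ1 : ‖inner ℂ (ρ⁻¹ • (w : Cn (m + 1))) (ξ : Cn (m + 1))‖ ≤ 1 := by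
        have := norm_inner_le_norm (𝕜 := ℂ) (ρ⁻¹ • (w : Cn (m + 1))) (ξ : Cn (m + 1))
        rw [mem_sphere_zero_iff_norm.mp hη, mem_sphere_zero_iff_norm.mp ξ.2] at this
        linarith
      have he : inner ℂ (w : Cn (m + 1)) (r • (ξ : Cn (m + 1))) =
          ((ρ * r : ℝ) : ℂ) * inner ℂ (ρ⁻¹ • (w : Cn (m + 1))) (ξ : Cn (m + 1)) := by
        have hρc : (ρ : ℂ) ≠ 0 := by exact_mod_cast hρ0.ne'
        rw [← Complex.coe_smul, ← Complex.coe_smul, inner_smul_left, inner_smul_right,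
          Complex.conj_ofReal]
        push_cast
        field_simp
      rw [he] at h2 h3
      simp only [Set.mem_ofPred_eq]
      set ζ := inner ℂ (ρ⁻¹ • (w : Cn (m + 1))) (ξ : Cn (m + 1))
      set a := ρ * r with ha
      have ha0 : r₀ ^ 2 / 2 ≤ a := by nlinarith
      have hapos : 0 < a := by positivity
      have ha1 : 1 - r ≤ 1 - a := by nlinarith
      have hD2 : ‖1 - (a : ℂ) * ζ‖ ^ 2 = (1 - a * ζ.re) ^ 2 + (a * ζ.im) ^ 2 := by
        rw [Complex.sq_norm, Complex.normSq_apply]; simp; ring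
      have hre : ζ.re ≤ 1 := (Complex.re_le_norm ζ).trans hζ1
      have h4 : τ ^ 2 * ‖1 - (a : ℂ) * ζ‖ ^ 2 ≤ τ ^ 2 * (8 * (1 - r)) ^ 2 := by gcongr
      have h5 : (r - ρ) ^ 2 + 2 * a * (1 - a) * (1 - ζ.re) + a ^ 2 * (1 - ζ.re) ^ 2 +
          (a * ζ.im) ^ 2 ≤ τ ^ 2 * (8 * (1 - r)) ^ 2 := by
        refine le_trans (le_of_eq ?_) (h2.trans h4)
        rw [hD2, ha]; ring
      have h6 : 0 ≤ 2 * a * (1 - a) * (1 - ζ.re) :=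
        mul_nonneg (mul_nonneg (by positivity) (by linarith)) (by linarith)
      constructor
      · have h7 : 2 * a * (1 - r) * (1 - ζ.re) ≤ τ ^ 2 * (8 * (1 - r)) ^ 2 := by
          have : 2 * a * (1 - r) * (1 - ζ.re) ≤ 2 * a * (1 - a) * (1 - ζ.re) := by
            have : 0 ≤ 1 - ζ.re := by linarith
            gcongr
          nlinarith [sq_nonneg (r - ρ), sq_nonneg (a * (1 - ζ.re)), sq_nonneg (a * ζ.im)]
        have h8 : a * (1 - ζ.re) ≤ 32 * τ ^ 2 * (1 - r) := by
          have : (1 - r) * (a * (1 - ζ.re)) ≤ (1 - r) * (32 * τ ^ 2 * (1 - r)) := by nlinarith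
          exact le_of_mul_le_mul_left this hh
        have h9 : r₀ ^ 2 / 2 * (1 - ζ.re) ≤ a * (1 - ζ.re) := by
          have : 0 ≤ 1 - ζ.re := by linarith
          gcongr
        rw [div_mul_eq_mul_div, le_div_iff₀ (by positivity)]
        linarith
      · have h7 : (a * ζ.im) ^ 2 ≤ (8 * τ * (1 - r)) ^ 2 := by
          nlinarith [sq_nonneg (r - ρ), sq_nonneg (a * (1 - ζ.re))]
        have h8 := abs_le_of_sq_le_sq h7 (by positivity)
        have h8' : a * |ζ.im| ≤ 8 * τ * (1 - r) := by
          rwa [abs_mul, abs_of_pos hapos] at h8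
        have h9 : r₀ ^ 2 / 2 * |ζ.im| ≤ a * |ζ.im| := by gcongr
        rw [div_mul_eq_mul_div, le_div_iff₀ (by positivity)]
        linarith
    · congr 1
      rw [mul_pow, mul_pow, ← pow_mul]
      ring

/-- Anisotropic balls of radius comparable to `1 - r` about points of the annulus have measure at
least comparable to `(1 - r)^n`. -/
lemma exists_le_sigma_ball_of_mem_annulus (m : ℕ) : ∃ c : ℝ, 0 < c ∧ ∀ (r : ℝ) (w : B (m + 1)),
    0 ≤ r → r < 1 → 1 - ‖(w : Cn (m + 1))‖ ≤ 8 * (1 - r) →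
    ENNReal.ofReal (c * (1 - r) ^ (m + 1)) ≤
      sigma (m + 1) {ξ | ‖1 - inner ℂ (w : Cn (m + 1)) (ξ : Cn (m + 1))‖ < 9 * (1 - r)} := by
  obtain ⟨c, hc, hball⟩ := exists_le_sigma_ball m
  refine ⟨c, hc, fun r w hr0 hr hw => ?_⟩
  obtain ⟨η, hη⟩ : ∃ η : S (m + 1), (w : Cn (m + 1)) = ‖(w : Cn (m + 1))‖ • (η : Cn (m + 1)) := by
    rcases eq_or_ne (w : Cn (m + 1)) 0 with h0 | h0
    · exact ⟨⟨EuclideanSpace.single 0 1, by simp⟩, by simp [h0]⟩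
    · refine ⟨⟨‖(w : Cn (m + 1))‖⁻¹ • (w : Cn (m + 1)), ?_⟩, ?_⟩
      · rw [mem_sphere_zero_iff_norm, norm_smul, norm_inv, norm_norm,
          inv_mul_cancel₀ (norm_ne_zero_iff.mpr h0)]
      · exact (smul_inv_smul₀ (norm_ne_zero_iff.mpr h0) _).symm
  refine (hball η (1 - r) (by linarith) (by linarith)).trans (measure_mono fun ξ hξ => ?_)
  simp only [Set.mem_ofPred_eq] at hξ ⊢
  rw [norm_one_sub_inner_comm] at hξ ⊢
  have hw1 : ‖(w : Cn (m + 1))‖ < 1 := mem_ball_zero_iff.mp w.2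
  have := norm_one_sub_inner_smul_le_add (a := (η : Cn (m + 1))) (w := (ξ : Cn (m + 1)))
    (by simp) (by simp) hw1.le
  rw [← hη] at this
  linarith

/-! ### Bounds for the Green potential -/

lemma norm_smul_sphere {n : ℕ} (ξ : S n) {r : ℝ} (hr : 0 ≤ r) : ‖r • (ξ : Cn n)‖ = r := by
  rw [norm_smul, mem_sphere_zero_iff_norm.mp ξ.2, Real.norm_of_nonneg hr, mul_one]

lemma norm_phi_le_one {n : ℕ} {w z : Cn n} (hw : ‖w‖ ≤ 1) (hz : ‖z‖ ≤ 1)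
    (h : 0 < ‖1 - inner ℂ w z‖) : ‖phi w z‖ ≤ 1 := by
  rw [← sq_le_one_iff₀ (norm_nonneg _), norm_phi_sq hw h]
  have h1 : 0 ≤ 1 - ‖w‖ ^ 2 := by nlinarith [norm_nonneg w]
  have h2 : 0 ≤ 1 - ‖z‖ ^ 2 := by nlinarith [norm_nonneg z]
  have : 0 ≤ (1 - ‖w‖ ^ 2) * (1 - ‖z‖ ^ 2) / ‖1 - inner ℂ w z‖ ^ 2 := by positivity
  linarith

/-- The integrability condition forces `μ` to have a density with respect to a finite measure. -/
lemma sFinite_of_lintegral_lt_top {n : ℕ} {μ : Measure (B n)}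
    (hμ : ∫⁻ w : B n, ENNReal.ofReal ((1 - ‖(w : Cn n)‖ ^ 2) ^ n) ∂μ < ∞) : SFinite μ := by
  have hm : Measurable fun w : B n => ENNReal.ofReal ((1 - ‖(w : Cn n)‖ ^ 2) ^ n) := by fun_prop
  have := isFiniteMeasure_withDensity hμ.ne
  have hne : ∀ w : B n, ENNReal.ofReal ((1 - ‖(w : Cn n)‖ ^ 2) ^ n) ≠ 0 := fun w => by
    have hw : ‖(w : Cn n)‖ < 1 := mem_ball_zero_iff.mp w.2
    rw [← pos_iff_ne_zero, ENNReal.ofReal_pos]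
    exact pow_pos (by nlinarith [norm_nonneg (w : Cn n)]) n
  have h := withDensity_inv_same (μ := μ) hm (.of_forall hne)
    (.of_forall fun _ => ENNReal.ofReal_ne_top)
  rw [← h]
  infer_instance

lemma lam_univ_lt_top {n : ℕ} {μ : Measure (B n)}
    (hμ : ∫⁻ w : B n, ENNReal.ofReal ((1 - ‖(w : Cn n)‖ ^ 2) ^ n) ∂μ < ∞) :
    lam μ Set.univ < ∞ := by
  rw [lam, withDensity_apply _ MeasurableSet.univ, Measure.restrict_univ]
  refine (lintegral_mono fun w => ENNReal.ofReal_le_ofReal ?_).trans_lt hμ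
  have hw : ‖(w : Cn n)‖ < 1 := mem_ball_zero_iff.mp w.2
  have h0 : 0 ≤ 1 - ‖(w : Cn n)‖ := by linarith
  gcongr
  nlinarith [norm_nonneg (w : Cn n)]

/-- On an anisotropic ball of radius `δ`, the Green function with pole at distance about `δ` from
the boundary dominates `((1 - |w|) / δ)^n`. -/
lemma exists_lam_carleson_le (n : ℕ) (hn : 1 < n) (r₀ : ℝ) (hr₀ : 0 < r₀) (hr₀' : r₀ < 1) :
    ∃ C : ℝ, 0 < C ∧ ∀ (μ : Measure (B n)) (δ : ℝ) (ξ : S n), 0 < δ → δ < 1 →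
      lam μ (carleson ξ δ) ≤
        ENNReal.ofReal (C * δ ^ n) * greenPotential μ (max (1 - δ) r₀ • (ξ : Cn n)) := by
  obtain ⟨c, hc, hg⟩ := exists_le_g n hn
  have hr1 : 0 < 1 - r₀ := by linarith
  refine ⟨(c * ((1 - r₀) / 4) ^ n)⁻¹, by positivity, fun μ δ ξ hδ hδ1 => ?_⟩
  set r := max (1 - δ) r₀
  have hr0 : 0 ≤ r := hr₀.le.trans (le_max_right _ _)
  have hr : r < 1 := max_lt (by linarith) hr₀'
  have hrδ : 1 - r ≤ δ := by linarith [le_max_left (1 - δ) r₀]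
  have hrδ' : (1 - r₀) * δ ≤ 1 - r := by
    rcases max_choice (1 - δ) r₀ with h | h <;> simp only [r, h] <;> nlinarith
  rw [lam, withDensity_apply _ (measurableSet_carleson ξ δ), greenPotential,
    ← lintegral_const_mul' _ _ ENNReal.ofReal_ne_top]
  refine (setLIntegral_mono' (measurableSet_carleson ξ δ) fun w hw => ?_).trans
    (setLIntegral_le_lintegral _ _)
  rw [mem_carleson] at hw
  have hw1 : ‖(w : Cn n)‖ < 1 := mem_ball_zero_iff.mp w.2
  have hz := norm_smul_sphere ξ hr0
  have h1 := norm_one_sub_inner_smul_le_add (a := (ξ : Cn n)) (by simp) hw1.le hr.le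
  have h2 := one_sub_le_norm_one_sub_inner_smul (a := (ξ : Cn n)) (by simp) hw1.le hr0
  have hD : 0 < ‖1 - inner ℂ (w : Cn n) (r • (ξ : Cn n))‖ := by linarith
  have hphi := norm_phi_sq hw1.le hD
  refine le_trans ?_ (mul_le_mul_right (hg (phi (w : Cn n) (r • (ξ : Cn n)))
    (norm_phi_le_one hw1.le (hz.trans_le hr.le) hD)) _)
  rw [hphi, hz, sub_sub_cancel, ← ENNReal.ofReal_mul (by positivity)]
  refine ENNReal.ofReal_le_ofReal ?_
  have hρ := norm_nonneg (w : Cn n)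
  set ρ := ‖(w : Cn n)‖
  set D := ‖1 - inner ℂ (w : Cn n) (r • (ξ : Cn n))‖
  have h3 : (1 - r₀) / 4 * ((1 - ρ) / δ) ≤ (1 - ρ ^ 2) * (1 - r ^ 2) / D ^ 2 := by
    rw [le_div_iff₀ (by positivity)]
    have h4 : D ^ 2 ≤ (2 * δ) ^ 2 := by gcongr; linarith
    have h5 : 0 ≤ 1 - ρ := by linarith
    calc (1 - r₀) / 4 * ((1 - ρ) / δ) * D ^ 2
        ≤ (1 - r₀) / 4 * ((1 - ρ) / δ) * (2 * δ) ^ 2 := by gcongr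
      _ = (1 - ρ) * ((1 - r₀) * δ) := by field_simp; ring
      _ ≤ (1 - ρ) * (1 - r) := by gcongr
      _ ≤ (1 - ρ ^ 2) * (1 - r ^ 2) := by
          gcongr <;> nlinarith
  have h5 : 0 ≤ (1 - ρ) / δ := div_nonneg (by linarith) hδ.le
  calc (1 - ρ) ^ n = (c * ((1 - r₀) / 4) ^ n)⁻¹ * δ ^ n *
        (c * ((1 - r₀) / 4 * ((1 - ρ) / δ)) ^ n) := by
        rw [mul_pow, div_pow (1 - ρ) δ]
        have : (1 - r₀) ^ n ≠ 0 := by positivity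
        field_simp
    _ ≤ _ := by gcongr

/-- Pointwise decomposition of the Green function: away from the pole into dyadic anisotropic balls
around the boundary point, near the pole into dyadic pseudo-hyperbolic balls. -/
lemma exists_green_le (m : ℕ) (hm : 0 < m) (r₀ : ℝ) (hr₀ : 0 < r₀) :
    ∃ C : ℝ, 0 < C ∧ ∀ (r : ℝ) (ξ : S (m + 1)) (w : B (m + 1)), r₀ ≤ r → r < 1 →
      green (r • (ξ : Cn (m + 1))) (w : Cn (m + 1)) ≤
        (∑' k : ℕ, ENNReal.ofReal (C * ((4 ^ k * (1 - r)) ^ (m + 1))⁻¹) *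
          (carleson ξ (2 ^ (k + 2) * (1 - r))).indicator
            (fun w => ENNReal.ofReal ((1 - ‖(w : Cn (m + 1))‖) ^ (m + 1))) w) +
        ∑' k : ℕ, (pseudoBall (r • (ξ : Cn (m + 1))) (r₀ / 4 / 2 ^ k)).indicator
          (fun _ => ENNReal.ofReal (C * (2 ^ k) ^ (2 * m))) w := by
  obtain ⟨C₁, hC₁, hfar⟩ := exists_g_le_of_le (m + 1) (by omega) (r₀ / 4) (by positivity)
  obtain ⟨C₂, hC₂, hnear⟩ := exists_g_le (m + 1) (by omega)
  refine ⟨max (C₁ * 4 ^ (m + 1)) (C₂ * (2 / (r₀ / 4)) ^ (2 * m)), by positivity,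
    fun r ξ w hr hr1 => ?_⟩
  set C := max (C₁ * 4 ^ (m + 1)) (C₂ * (2 / (r₀ / 4)) ^ (2 * m))
  have hC : 0 < C := by positivity
  have hr0 : 0 ≤ r := hr₀.le.trans hr
  have hh : 0 < 1 - r := by linarith
  have hw1 : ‖(w : Cn (m + 1))‖ < 1 := mem_ball_zero_iff.mp w.2
  have hz := norm_smul_sphere ξ hr0
  have h1 := norm_one_sub_inner_le_add (a := (ξ : Cn (m + 1))) (by simp) hw1.le hr1.le
  have h2 := one_sub_le_norm_one_sub_inner_smul (a := (ξ : Cn (m + 1))) (by simp) hw1.le hr0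
  have hD : 0 < ‖1 - inner ℂ (w : Cn (m + 1)) (r • (ξ : Cn (m + 1)))‖ := by linarith
  have hphi := norm_phi_sq hw1.le hD
  have hphi1 := norm_phi_le_one hw1.le (hz.trans_le hr1.le) hD
  rcases le_or_gt (r₀ / 4) ‖phi (w : Cn (m + 1)) (r • (ξ : Cn (m + 1)))‖ with hc | hc
  · refine le_add_right ?_
    obtain ⟨k, hk1, hk2⟩ := exists_nat_pow_near (x :=
      ‖1 - inner ℂ (w : Cn (m + 1)) (r • (ξ : Cn (m + 1)))‖ / (1 - r))
      ((one_le_div hh).mpr h2) one_lt_two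
    refine le_trans ?_ (ENNReal.le_tsum k)
    rw [le_div_iff₀ hh] at hk1
    rw [div_lt_iff₀ hh] at hk2
    have hk3 : (2 : ℝ) ^ (k + 2) = 2 * 2 ^ (k + 1) := by ring
    rw [Set.indicator_of_mem (mem_carleson.mpr (by rw [hk3]; linarith))]
    refine (hfar _ hc hphi1).trans ?_
    have hρ := norm_nonneg (w : Cn (m + 1))
    rw [hphi, hz, sub_sub_cancel, ← ENNReal.ofReal_mul (by positivity)]
    refine ENNReal.ofReal_le_ofReal ?_
    set ρ := ‖(w : Cn (m + 1))‖
    set D := ‖1 - inner ℂ (w : Cn (m + 1)) (r • (ξ : Cn (m + 1)))‖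
    have h0 : 0 ≤ 1 - ρ := by linarith
    have h3 : (1 - ρ ^ 2) * (1 - r ^ 2) / D ^ 2 ≤ 4 * ((4 ^ k * (1 - r))⁻¹ * (1 - ρ)) := by
      rw [div_le_iff₀ (by positivity)]
      have h4 : (2 ^ k * (1 - r)) ^ 2 ≤ D ^ 2 := by gcongr
      have h5 : ((2 : ℝ) ^ k) ^ 2 = 4 ^ k := by rw [← pow_mul, mul_comm, pow_mul]; norm_num
      calc (1 - ρ ^ 2) * (1 - r ^ 2) = ((1 + ρ) * (1 + r)) * ((1 - ρ) * (1 - r)) := by ring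
        _ ≤ 4 * ((1 - ρ) * (1 - r)) := by gcongr; nlinarith
        _ = 4 * ((4 ^ k * (1 - r))⁻¹ * (1 - ρ)) * (2 ^ k * (1 - r)) ^ 2 := by
            rw [mul_pow, h5]; field_simp
        _ ≤ _ := by gcongr
    have h6 : 0 ≤ (1 - ρ ^ 2) * (1 - r ^ 2) / D ^ 2 := by
      have : 0 ≤ 1 - ρ ^ 2 := by nlinarith
      have : 0 ≤ 1 - r ^ 2 := by nlinarith
      positivity
    calc C₁ * ((1 - ρ ^ 2) * (1 - r ^ 2) / D ^ 2) ^ (m + 1)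
        ≤ C₁ * (4 * ((4 ^ k * (1 - r))⁻¹ * (1 - ρ))) ^ (m + 1) := by gcongr
      _ = C₁ * 4 ^ (m + 1) * ((4 ^ k * (1 - r)) ^ (m + 1))⁻¹ * (1 - ρ) ^ (m + 1) := by
          rw [mul_pow, mul_pow, inv_pow]; ring
      _ ≤ _ := by
          gcongr
          exact le_max_left _ _
  · refine le_add_left ?_
    rcases eq_or_ne (phi (w : Cn (m + 1)) (r • (ξ : Cn (m + 1)))) 0 with h0 | h0
    · -- At the pole every term of the series is bounded below by a positive constant.
      refine le_top.trans ?_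
      rw [← ENNReal.tsum_const_eq_top_of_ne_zero (α := ℕ) (ENNReal.ofReal_pos.mpr hC).ne']
      refine ENNReal.tsum_le_tsum fun k => ?_
      rw [Set.indicator_of_mem ((mem_pseudoBall (by positivity) hD).mpr (by
        rw [h0, norm_zero]; positivity))]
      exact ENNReal.ofReal_le_ofReal (le_mul_of_one_le_right hC.le
        (one_le_pow₀ (one_le_pow₀ one_le_two)))
    · have hp : 0 < ‖phi (w : Cn (m + 1)) (r • (ξ : Cn (m + 1)))‖ := norm_pos_iff.mpr h0
      obtain ⟨k, hk1, hk2⟩ := exists_nat_pow_near (x :=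
        (r₀ / 4) / ‖phi (w : Cn (m + 1)) (r • (ξ : Cn (m + 1)))‖)
        ((one_le_div hp).mpr hc.le) one_lt_two
      refine le_trans ?_ (ENNReal.le_tsum k)
      rw [le_div_iff₀ hp] at hk1
      rw [div_lt_iff₀ hp] at hk2
      rw [Set.indicator_of_mem ((mem_pseudoBall (by positivity) hD).mpr (by
        rw [le_div_iff₀ (by positivity)]; linarith))]
      refine (hnear _ h0 hphi1).trans (ENNReal.ofReal_le_ofReal ?_)
      rw [Nat.add_sub_cancel]
      have h3 : ‖phi (w : Cn (m + 1)) (r • (ξ : Cn (m + 1)))‖⁻¹ ≤ 2 / (r₀ / 4) * 2 ^ k := by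
        rw [inv_le_iff_one_le_mul₀ hp, div_mul_eq_mul_div, div_mul_eq_mul_div,
          one_le_div (by positivity)]
        rw [pow_succ] at hk2
        linarith
      calc C₂ * (‖phi (w : Cn (m + 1)) (r • (ξ : Cn (m + 1)))‖ ^ (2 * m))⁻¹
          ≤ C₂ * (2 / (r₀ / 4) * 2 ^ k) ^ (2 * m) := by
            rw [← inv_pow]; gcongr
        _ = C₂ * (2 / (r₀ / 4)) ^ (2 * m) * (2 ^ k) ^ (2 * m) := by rw [mul_pow]; ring
        _ ≤ _ := by
            gcongr
            exact le_max_right _ _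

lemma exists_greenPotential_le (m : ℕ) (hm : 0 < m) (r₀ : ℝ) (hr₀ : 0 < r₀) :
    ∃ C : ℝ, 0 < C ∧ ∀ (μ : Measure (B (m + 1))) (r : ℝ) (ξ : S (m + 1)), r₀ ≤ r → r < 1 →
      greenPotential μ (r • (ξ : Cn (m + 1))) ≤
        (∑' k : ℕ, ENNReal.ofReal (C * ((4 ^ k * (1 - r)) ^ (m + 1))⁻¹) *
          lam μ (carleson ξ (2 ^ (k + 2) * (1 - r)))) +
        ∑' k : ℕ, ENNReal.ofReal (C * (2 ^ k) ^ (2 * m)) *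
          μ (pseudoBall (r • (ξ : Cn (m + 1))) (r₀ / 4 / 2 ^ k)) := by
  obtain ⟨C, hC, h⟩ := exists_green_le m hm r₀ hr₀
  refine ⟨C, hC, fun μ r ξ hr hr1 => (lintegral_mono fun w => h r ξ w hr hr1).trans_eq ?_⟩
  have hm1 : Measurable fun w : B (m + 1) =>
      ENNReal.ofReal ((1 - ‖(w : Cn (m + 1))‖) ^ (m + 1)) := by fun_prop
  rw [lintegral_add_left (Measurable.tsum fun k =>
      (hm1.indicator (measurableSet_carleson ξ _)).const_mul _),
    lintegral_tsum fun k => ((hm1.indicator (measurableSet_carleson ξ _)).const_mul _).aemeasurable,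
    lintegral_tsum fun k =>
      (measurable_const.indicator (measurableSet_pseudoBall ξ _ _)).aemeasurable]
  congr 2
  · ext k
    rw [lintegral_const_mul' _ _ ENNReal.ofReal_ne_top,
      lintegral_indicator (measurableSet_carleson ξ _), lam,
      withDensity_apply _ (measurableSet_carleson ξ _)]
  · ext k
    rw [lintegral_indicator (measurableSet_pseudoBall ξ _ _), setLIntegral_const]

/-! ### The two implications -/

/-- The `L^p` mean of the `μ`-measures of the pseudo-hyperbolic balls of radius `τ` gains the
factor `τ^{(2n-1)/p}`, which is what makes the local singularity of the Green function harmless. -/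
lemma exists_lintegral_pseudoBall_le (m : ℕ) (p : ℝ) (hp : 1 < p) (r₀ : ℝ) (hr₀ : 0 < r₀)
    (hr₀' : r₀ < 1) (μ : Measure (B (m + 1))) [SFinite μ] (K : ℝ≥0∞) (hK : K ≠ ∞)
    (hcar : ∀ δ : ℝ, 0 < δ → (∫⁻ ξ, lam μ (carleson ξ δ) ^ p ∂(sigma (m + 1))) ^ (1 / p) ≤
      K * ENNReal.ofReal (δ ^ (m + 1))) :
    ∃ C : ℝ≥0∞, C ≠ ∞ ∧ ∀ r τ : ℝ, r₀ ≤ r → r < 1 → 0 < τ → τ ≤ r₀ / 4 →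
      (∫⁻ ξ : S (m + 1), μ (pseudoBall (r • (ξ : Cn (m + 1))) τ) ^ p ∂(sigma (m + 1))) ^ (1 / p) ≤
        C * ENNReal.ofReal (τ ^ ((2 * m + 1) / p)) := by
  obtain ⟨C₁, hC₁, hup⟩ := exists_sigma_pseudoBall_le m r₀ hr₀ hr₀'
  obtain ⟨c, hc, hlow⟩ := exists_le_sigma_ball_of_mem_annulus m
  have hp0 : 0 < p := by linarith
  refine ⟨ENNReal.ofReal ((C₁ / c) ^ (1 / p)) * (K * ENNReal.ofReal (3200 ^ (m + 1))),
    ENNReal.mul_ne_top ENNReal.ofReal_ne_top (ENNReal.mul_ne_top hK ENNReal.ofReal_ne_top),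
    fun r τ hr hr1 hτ hτ' => ?_⟩
  have hr0 : 0 ≤ r := hr₀.le.trans hr
  have hh : 0 < 1 - r := by linarith
  have hτ2 : τ ^ 2 ≤ 1 / 2 := by nlinarith
  let A : Set (B (m + 1)) :=
    {w | (1 - r) / 8 ≤ 1 - ‖(w : Cn (m + 1))‖ ∧ 1 - ‖(w : Cn (m + 1))‖ ≤ 8 * (1 - r)}
  have hA : MeasurableSet A :=
    ((isClosed_le (g := fun w : B (m + 1) => 1 - ‖(w : Cn (m + 1))‖) continuous_const
      (by fun_prop)).inter (isClosed_le (f := fun w : B (m + 1) => 1 - ‖(w : Cn (m + 1))‖)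
      (by fun_prop) continuous_const)).measurableSet
  have hball : ∀ (ξ : S (m + 1)) (w : B (m + 1)), w ∈ pseudoBall (r • (ξ : Cn (m + 1))) τ →
      w ∈ A ∧ ‖1 - inner ℂ (w : Cn (m + 1)) (ξ : Cn (m + 1))‖ ≤ 9 * (1 - r) := by
    intro ξ w hw
    obtain ⟨h1, h2, h3⟩ := bounds_of_mem_pseudoBall hr0 hr1 hτ2 hw
    have h4 := norm_one_sub_inner_le_add (a := (ξ : Cn (m + 1))) (by simp)
      (mem_ball_zero_iff.mp w.2).le hr1.le
    exact ⟨⟨h1, h2⟩, by linarith⟩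
  have hmain := lintegral_measure_slice_rpow_le (σ := sigma (m + 1)) (μ := μ) hp
    (E := {q : S (m + 1) × B (m + 1) | q.2 ∈ pseudoBall (r • (q.1 : Cn (m + 1))) τ})
    (F := (Prod.snd ⁻¹' A) ∩ {q : S (m + 1) × B (m + 1) |
      ‖1 - inner ℂ (q.2 : Cn (m + 1)) (q.1 : Cn (m + 1))‖ < 9 * (1 - r)})
    (measurableSet_pseudoBall_prod _ _ _)
    ((measurable_snd hA).inter (isOpen_lt (by fun_prop) (by fun_prop)).measurableSet)
    (U := (Prod.snd ⁻¹' A) ∩ {q : B (m + 1) × B (m + 1) |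
      ‖1 - inner ℂ (q.2 : Cn (m + 1)) (q.1 : Cn (m + 1))‖ ≤ 72 * (1 - r)})
    ((measurable_snd hA).inter (isClosed_le (by fun_prop) (by fun_prop)).measurableSet)
    (fun ξ => A ∩ carleson ξ (400 * (1 - r))) (ENNReal.ofReal (C₁ / c * τ ^ (2 * m + 1)))
    ENNReal.ofReal_ne_top ?_ ?_ ?_ ?_
  · have hG : ∀ ξ : S (m + 1), μ (A ∩ carleson ξ (400 * (1 - r))) ≤
        ENNReal.ofReal ((8 / (1 - r)) ^ (m + 1)) * lam μ (carleson ξ (400 * (1 - r))) := by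
      intro ξ
      rw [lam, withDensity_apply _ (measurableSet_carleson ξ _),
        ← lintegral_const_mul' _ _ ENNReal.ofReal_ne_top, ← setLIntegral_one]
      refine (setLIntegral_mono' (hA.inter (measurableSet_carleson ξ _)) fun w hw => ?_).trans
        (lintegral_mono_set Set.inter_subset_right)
      rw [← ENNReal.ofReal_mul (by positivity), ← ENNReal.ofReal_one, ← mul_pow]
      refine ENNReal.ofReal_le_ofReal (one_le_pow₀ ?_)
      rw [div_mul_eq_mul_div, one_le_div hh]
      linarith [hw.1.1]
    calc (∫⁻ ξ : S (m + 1), μ (pseudoBall (r • (ξ : Cn (m + 1))) τ) ^ p ∂(sigma (m + 1))) ^ (1 / p)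
        ≤ (ENNReal.ofReal (C₁ / c * τ ^ (2 * m + 1)) *
            ∫⁻ ξ, μ (A ∩ carleson ξ (400 * (1 - r))) ^ p ∂(sigma (m + 1))) ^ (1 / p) := by
          exact ENNReal.rpow_le_rpow hmain (by positivity)
      _ = ENNReal.ofReal ((C₁ / c) ^ (1 / p)) * ENNReal.ofReal (τ ^ ((2 * m + 1) / p)) *
            (∫⁻ ξ, μ (A ∩ carleson ξ (400 * (1 - r))) ^ p ∂(sigma (m + 1))) ^ (1 / p) := by
          rw [ENNReal.mul_rpow_of_nonneg _ _ (by positivity),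
            ENNReal.ofReal_rpow_of_nonneg (by positivity) (by positivity),
            Real.mul_rpow (by positivity) (by positivity), ENNReal.ofReal_mul (by positivity),
            ← Real.rpow_natCast_mul hτ.le]
          congr 4
          push_cast; ring
      _ ≤ ENNReal.ofReal ((C₁ / c) ^ (1 / p)) * ENNReal.ofReal (τ ^ ((2 * m + 1) / p)) *
            (ENNReal.ofReal ((8 / (1 - r)) ^ (m + 1)) *
              (K * ENNReal.ofReal ((400 * (1 - r)) ^ (m + 1)))) := by
          gcongr
          refine le_trans ?_ (mul_le_mul_right (hcar (400 * (1 - r)) (by positivity)) _)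
          rw [← lintegral_Lp_const_mul hp0 ENNReal.ofReal_ne_top]
          gcongr with ξ
          exact hG ξ
      _ = _ := by
          have : (3200 : ℝ) ^ (m + 1) = (8 / (1 - r)) ^ (m + 1) * (400 * (1 - r)) ^ (m + 1) := by
            rw [← mul_pow]; congr 1; field_simp; norm_num
          rw [this, ENNReal.ofReal_mul (by positivity)]
          ring
  · intro ξ w w' hw hw'
    obtain ⟨-, h1⟩ := hball ξ w hw
    obtain ⟨h2, h3⟩ := hball ξ w' hw'
    refine ⟨h2, ?_⟩
    have h4 := norm_one_sub_inner_le (a := (w : Cn (m + 1))) (b := (ξ : Cn (m + 1)))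
      (c := (w' : Cn (m + 1))) (mem_ball_zero_iff.mp w.2).le (by simp)
      (mem_ball_zero_iff.mp w'.2).le
    rw [norm_one_sub_inner_comm (w : Cn (m + 1)) (ξ : Cn (m + 1))] at h4
    simp only [Set.mem_ofPred_eq]
    linarith
  · intro w
    by_cases hw : w ∈ A
    · have h1 := hlow r w hr0 hr1 hw.2
      have h2 : {ξ : S (m + 1) | (ξ, w) ∈ (Prod.snd ⁻¹' A) ∩ {q : S (m + 1) × B (m + 1) |
          ‖1 - inner ℂ (q.2 : Cn (m + 1)) (q.1 : Cn (m + 1))‖ < 9 * (1 - r)}} =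
          {ξ : S (m + 1) |
            ‖1 - inner ℂ (w : Cn (m + 1)) (ξ : Cn (m + 1))‖ < 9 * (1 - r)} := by
        ext ξ; simp [hw]
      rw [h2]
      refine (hup r τ w hr hr1 hτ hτ').trans (le_trans (le_of_eq ?_) (mul_le_mul_right h1 _))
      rw [← ENNReal.ofReal_mul (by positivity)]
      congr 1
      field_simp
    · have : {ξ : S (m + 1) | (ξ, w) ∈ {q : S (m + 1) × B (m + 1) |
          q.2 ∈ pseudoBall (r • (q.1 : Cn (m + 1))) τ}} = ∅ :=
        Set.eq_empty_of_forall_notMem fun ξ hξ => hw (hball ξ w hξ).1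
      rw [this, measure_empty]
      exact zero_le
  · rintro ξ w ⟨h1, h2⟩
    simp only [Set.mem_ofPred_eq] at h2
    exact ⟨h1, mem_carleson.mpr (by linarith)⟩
  · rintro ξ w w' ⟨-, h1⟩ ⟨h2, h3⟩
    simp only [Set.mem_ofPred_eq] at h1 h3
    refine ⟨h2, mem_carleson.mpr ?_⟩
    have h4 := norm_one_sub_inner_le (a := (ξ : Cn (m + 1))) (b := (w : Cn (m + 1)))
      (c := (w' : Cn (m + 1))) (by simp) (mem_ball_zero_iff.mp w.2).le
      (mem_ball_zero_iff.mp w'.2).le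
    linarith

lemma tsum_const_mul_ofReal_pow_ne_top {a : ℝ≥0∞} (ha : a ≠ ∞) {q : ℝ} (hq : q < 1) :
    ∑' k : ℕ, a * ENNReal.ofReal q ^ k ≠ ∞ := by
  rw [ENNReal.tsum_mul_left, ENNReal.tsum_geometric]
  refine ENNReal.mul_ne_top ha (ENNReal.inv_ne_top.mpr ?_)
  rw [← pos_iff_ne_zero, tsub_pos_iff_lt, ENNReal.ofReal_lt_one]
  exact hq

/-- The averaged Carleson condition bounds the `L^p` means of the Green potential. -/
lemma exists_pMean_le (m : ℕ) (hm : 0 < m) (p : ℝ) (hp : 1 < p)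
    (hp2 : p < (2 * m + 1) / (2 * m)) (r₀ : ℝ) (hr₀ : 0 < r₀) (hr₀' : r₀ < 1)
    (μ : Measure (B (m + 1))) [SFinite μ] (K : ℝ≥0∞) (hK : K ≠ ∞)
    (hcar : ∀ δ : ℝ, 0 < δ → (∫⁻ ξ, lam μ (carleson ξ δ) ^ p ∂(sigma (m + 1))) ^ (1 / p) ≤
      K * ENNReal.ofReal (δ ^ (m + 1))) :
    ∃ M : ℝ≥0∞, M ≠ ∞ ∧ ∀ r : ℝ, r₀ ≤ r → r < 1 → pMean p r (greenPotential μ) ≤ M := by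
  obtain ⟨C, hC, hpot⟩ := exists_greenPotential_le m hm r₀ hr₀
  obtain ⟨N, hN, hnear⟩ := exists_lintegral_pseudoBall_le m p hp r₀ hr₀ hr₀' μ K hK hcar
  have hp0 : 0 < p := by linarith
  have hs : (2 * m : ℝ) < (2 * m + 1) / p := by
    have hm' : (0 : ℝ) < 2 * m := by positivity
    rw [lt_div_iff₀ hm'] at hp2
    rw [lt_div_iff₀ hp0]; linarith
  set s : ℝ := (2 * m + 1) / p
  have hsf : SFinite (lam μ) := by rw [lam]; infer_instance
  refine ⟨(∑' k : ℕ, K * ENNReal.ofReal (C * 4 ^ (m + 1)) * ENNReal.ofReal (1 / 2) ^ k) +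
    ∑' k : ℕ, N * ENNReal.ofReal (C * (r₀ / 4) ^ s) * ENNReal.ofReal (2 ^ (2 * m) / 2 ^ s) ^ k,
    ENNReal.add_ne_top.mpr ⟨?_, ?_⟩, fun r hr hr1 => ?_⟩
  · exact tsum_const_mul_ofReal_pow_ne_top (ENNReal.mul_ne_top hK ENNReal.ofReal_ne_top)
      (by norm_num)
  · refine tsum_const_mul_ofReal_pow_ne_top (ENNReal.mul_ne_top hN ENNReal.ofReal_ne_top) ?_
    rw [div_lt_one (by positivity), ← Real.rpow_natCast]
    exact Real.rpow_lt_rpow_of_exponent_lt one_lt_two (by push_cast; exact hs)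
  have hh : 0 < 1 - r := by linarith
  have hmeas1 : ∀ k : ℕ, Measurable fun ξ : S (m + 1) =>
      ENNReal.ofReal (C * ((4 ^ k * (1 - r)) ^ (m + 1))⁻¹) *
        lam μ (carleson ξ (2 ^ (k + 2) * (1 - r))) := fun k =>
    (measurable_measure_prodMk_left (measurableSet_carleson_prod _ _)).const_mul _
  have hmeas2 : ∀ k : ℕ, Measurable fun ξ : S (m + 1) => ENNReal.ofReal (C * (2 ^ k) ^ (2 * m)) *
      μ (pseudoBall (r • (ξ : Cn (m + 1))) (r₀ / 4 / 2 ^ k)) := fun k =>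
    (measurable_measure_prodMk_left (measurableSet_pseudoBall_prod _ _ _)).const_mul _
  calc pMean p r (greenPotential μ)
      ≤ (∫⁻ ξ : S (m + 1), ((fun ξ : S (m + 1) => ∑' k : ℕ,
            ENNReal.ofReal (C * ((4 ^ k * (1 - r)) ^ (m + 1))⁻¹) *
              lam μ (carleson ξ (2 ^ (k + 2) * (1 - r)))) +
          fun ξ : S (m + 1) => ∑' k : ℕ, ENNReal.ofReal (C * (2 ^ k) ^ (2 * m)) *
            μ (pseudoBall (r • (ξ : Cn (m + 1))) (r₀ / 4 / 2 ^ k))) ξ ^ p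
              ∂(sigma (m + 1))) ^ (1 / p) := by
        rw [pMean]
        gcongr with ξ
        exact hpot μ r ξ hr hr1
    _ ≤ _ := ENNReal.lintegral_Lp_add_le (Measurable.tsum hmeas1).aemeasurable
        (Measurable.tsum hmeas2).aemeasurable hp.le
    _ ≤ _ := add_le_add (lintegral_Lp_tsum_le hp.le hmeas1) (lintegral_Lp_tsum_le hp.le hmeas2)
    _ ≤ _ := by
        refine add_le_add (ENNReal.tsum_le_tsum fun k => ?_) (ENNReal.tsum_le_tsum fun k => ?_)
        · rw [lintegral_Lp_const_mul hp0 ENNReal.ofReal_ne_top]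
          refine (mul_le_mul_right (hcar _ (by positivity)) _).trans ?_
          rw [mul_left_comm, ← ENNReal.ofReal_mul (by positivity), mul_assoc K,
            ← ENNReal.ofReal_pow (by positivity), ← ENNReal.ofReal_mul (by positivity)]
          gcongr K * ENNReal.ofReal ?_
          have h1 : ((4 ^ k * (1 - r)) ^ (m + 1))⁻¹ * (2 ^ (k + 2) * (1 - r)) ^ (m + 1) =
              4 ^ (m + 1) * ((1 / 2 : ℝ) ^ k) ^ (m + 1) := by
            rw [← inv_pow, ← mul_pow, ← mul_pow]
            congr 1
            have : (4 : ℝ) ^ k = 2 ^ k * 2 ^ k := by rw [← mul_pow]; norm_num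
            rw [this, pow_add, div_pow, one_pow]
            field_simp
            norm_num
          rw [mul_assoc, h1, mul_assoc]
          gcongr
          exact pow_le_of_le_one (by positivity) (pow_le_one₀ (by norm_num) (by norm_num))
            (by omega)
        · rw [lintegral_Lp_const_mul hp0 ENNReal.ofReal_ne_top]
          refine (mul_le_mul_right (hnear r _ hr hr1 (by positivity)
            (div_le_self (by positivity) (one_le_pow₀ one_le_two))) _).trans (le_of_eq ?_)
          rw [mul_left_comm, ← ENNReal.ofReal_mul (by positivity), mul_assoc N,
            ← ENNReal.ofReal_pow (by positivity), ← ENNReal.ofReal_mul (by positivity)]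
          congr 2
          have h1 : ((2 : ℝ) ^ k) ^ s = (2 ^ s) ^ k := by
            rw [← Real.rpow_natCast_mul zero_le_two, ← Real.rpow_mul_natCast zero_le_two, mul_comm]
          rw [Real.div_rpow (by positivity) (by positivity), h1, div_pow, ← pow_mul,
            ← pow_mul, mul_comm k]
          ring

end InvariantGreen

theorem corollary1 (n : ℕ) (hn : 1 < n) (p : ℝ) (hp1 : 1 < p)
    (hp2 : p < (2 * (n : ℝ) - 1) / (2 * ((n : ℝ) - 1)))
    (μ : Measure (InvariantGreen.B n))
    (hμ : ∫⁻ w : InvariantGreen.B n,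
      ENNReal.ofReal ((1 - ‖(w : InvariantGreen.Cn n)‖ ^ 2) ^ n) ∂μ < ∞)
    (r₀ : ℝ) (hr₀ : 0 < r₀) (hr₀' : r₀ < 1) :
    (∃ K : ℝ≥0, ∀ r : ℝ, r₀ ≤ r → r < 1 →
      InvariantGreen.pMean p r (InvariantGreen.greenPotential μ) ≤ K) ↔
    (∃ K : ℝ≥0, ∀ δ : ℝ, 0 < δ → δ < 1 →
      (∫⁻ ξ : InvariantGreen.S n,
        (InvariantGreen.lam μ (InvariantGreen.carleson ξ δ)) ^ p ∂(InvariantGreen.sigma n))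
          ^ (1 / p) ≤ K * ENNReal.ofReal (δ ^ n)) := by
  have hp0 : 0 < p := by linarith
  constructor
  · rintro ⟨K, hK⟩
    obtain ⟨C, hC, hle⟩ := InvariantGreen.exists_lam_carleson_le n hn r₀ hr₀ hr₀'
    refine ⟨C.toNNReal * K, fun δ hδ hδ1 => ?_⟩
    calc _ ≤ (∫⁻ ξ : InvariantGreen.S n, (ENNReal.ofReal (C * δ ^ n) *
            InvariantGreen.greenPotential μ
              (max (1 - δ) r₀ • (ξ : InvariantGreen.Cn n))) ^ p
                ∂(InvariantGreen.sigma n)) ^ (1 / p) := by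
          gcongr with ξ
          exact hle μ δ ξ hδ hδ1
      _ ≤ ENNReal.ofReal (C * δ ^ n) * K := by
          rw [InvariantGreen.lintegral_Lp_const_mul hp0 ENNReal.ofReal_ne_top]
          exact mul_le_mul_right (hK _ (le_max_right _ _) (max_lt (by linarith) hr₀')) _
      _ = _ := by
          rw [ENNReal.ofReal_mul hC.le, ENNReal.coe_mul, mul_right_comm]; rfl
  · rintro ⟨K, hK⟩
    obtain ⟨m, rfl⟩ : ∃ m, n = m + 1 := ⟨n - 1, by omega⟩
    have := InvariantGreen.sFinite_of_lintegral_lt_top hμ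
    have hlam := InvariantGreen.lam_univ_lt_top hμ
    obtain ⟨M, hM, h⟩ := InvariantGreen.exists_pMean_le m (by omega) p hp1
      (by push_cast at hp2; convert hp2 using 2 <;> ring) r₀ hr₀ hr₀' μ
      (max K (InvariantGreen.lam μ Set.univ)) (max_lt ENNReal.coe_lt_top hlam).ne (fun δ hδ => by
        rcases lt_or_ge δ 1 with hδ1 | hδ1
        · refine (hK δ hδ hδ1).trans ?_
          gcongr
          exact le_max_left _ _
        · -- For `δ ≥ 1` the finiteness of the total mass suffices.
          calc _ ≤ (∫⁻ _ : InvariantGreen.S (m + 1), InvariantGreen.lam μ Set.univ ^ p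
                  ∂(InvariantGreen.sigma (m + 1))) ^ (1 / p) := by
                gcongr
                exact Set.subset_univ _
            _ ≤ (InvariantGreen.lam μ Set.univ ^ p) ^ (1 / p) := by
                rw [lintegral_const]
                gcongr
                exact mul_le_of_le_one_right' (InvariantGreen.sigma_univ_le_one _)
            _ = InvariantGreen.lam μ Set.univ := by
                rw [← ENNReal.rpow_mul, mul_one_div_cancel hp0.ne', ENNReal.rpow_one]
            _ ≤ _ := by
                refine (le_max_right (K : ℝ≥0∞) _).trans (le_mul_of_one_le_right' ?_)
                rw [ENNReal.one_le_ofReal]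
                exact one_le_pow₀ hδ1)
    exact ⟨M.toNNReal, fun r hr hr1 => by rw [ENNReal.coe_toNNReal hM]; exact h r hr hr1⟩
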